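/- Let $p\ge 0$, $q\ge 1$, let $X\subset\mathbb{C}$ be a finite set, let $\omega_{1,1},\dots,\omega_{1,p},\omega_{2,1},\dots,\omega_{2,q}$ be complex-valued functions without zeroes on $X$, and let $n_1,\dots,n_p,m_1,\dots,m_q\ge 0$ be integers with $\sum_i n_i=\sum_j m_j=N$. Let $\phi_1,\dots,\phi_N$ be the functions $\omega_{1,i}(x)x^k$ ($1\le i\le p$, $0\le k<n_i$) and $\psi_1,\dots,\psi_N$ the functions $\omega_{2,j}(x)x^k$ ($1\le j\le q$, $0\le k<m_j$), and assume that $$Z=\sum_{x_1,\dots,x_N\in X}\det[\phi_i(x_j)]_{i,j=1}^N\,\det[\psi_i(x_j)]_{i,j=1}^N\neq 0 .$$ Put $K(x,y)=\sum_{i,j=1}^N M_{ij}\phi_i(x)\psi_j(y)$, where $M$ is the inverse transpose of the matrix $\big(\sum_{x\in X}\phi_i(x)\psi_j(x)\big)_{i,j}$. On $\mathbb{P}^1$ let $L_\varnothing=\bigoplus_{i=1}^p\mathcal{O}(n_i-1)\oplus\bigoplus_{j=1}^q\mathcal{O}(-m_j-1)$, where $\mathcal{O}(d)=\mathcal{O}(d\cdot\infty)$.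 For $Y\subset X$ let $L_Y$ be the vector bundle that coincides with $L_\varnothing$ outside $Y$ and whose sections near $y\in Y$ are the rational sections $s=(s_{1,1},\dots,s_{1,p};s_{2,1},\dots,s_{2,q})^t$ of $L_\varnothing$ such that all $s_{1,i}$ are regular at $y$, all $s_{2,i}$ have at most a simple pole at $y$, and $\operatorname{res}_y s_{2,i}=-\omega_{2,i}(y)\sum_{j=1}^p\omega_{1,j}(y)s_{1,j}(y)$ for $i=1,\dots,q$. For $x\in X$ put $w_x=(0;\omega_{2,1}(x),\dots,\omega_{2,q}(x))^t$, $w'_x=(\omega_{1,1}(x),\dots,\omega_{1,p}(x);0)^t$, $w''_x=(0;\tfrac1{\omega_{2,1}(x)},0,\dots,0)^t$. For a vector bundle $L$ on $\mathbb{P}^1$ put $\det R\Gamma(L)=\det H^0(\mathbb{P}^1,L)\otimes(\det H^1(\mathbb{P}^1,L))^{-1}$, where $\det V$ is the top exterior power and $V^{-1}$ is the dual of a line $V$. For $L$ of rank $r$ and degree $-r$ let $\tau(L)\in\det R\Gamma(L)^{-1}$ be the canonical element $1$ if $L\simeq\mathcal{O}(-1)^r$ (then $H^0=H^1=0$ and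 $\det R\Gamma(L)=\mathbb{C}$), and $\tau(L)=0$ otherwise. For $Y\subset X$ identify $\det R\Gamma(L_Y)$ with $\det R\Gamma(L_X)$ as follows. Let $L_Y^{up}$ coincide with $L_Y$ outside $X\setminus Y$, with sections near $x\in X\setminus Y$ the rational sections $s$ of $L_Y$ such that all $s_{1,i}$ are regular at $x$, all $s_{2,i}$ have at most a simple pole at $x$, and $\operatorname{res}_x s\in\mathbb{C}w_x$. Then $L_Y$ and $L_X$ are subsheaves of $L_Y^{up}$. The functionals $f_x(s)=\langle w'_x+w''_x(z-x),s\rangle|_{z=x}$ and $g_x(s)=\operatorname{res}_x s/w_x$, $x\in X\setminus Y$, give isomorphisms $f$ of $H^0(\mathbb{P}^1,L_Y^{up}/L_X)$ and $g$ of $H^0(\mathbb{P}^1,L_Y^{up}/L_Y)$ with $\mathbb{C}^{X\setminus Y}$. The exact cohomology sequences of $0\to L\to L_Y^{up}\to L_Y^{up}/L\to 0$ give canonical isomorphisms $\det R\Gamma(L)\simeq\det H^0(\mathbb{P}^1,L_Y^{up})\otimes(\det H^0(\mathbb{P}^1,L_Y^{up}/L))^{-1}$ for $L=L_Y$ and $L=L_X$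 (here $H^1(\mathbb{P}^1,L_Y^{up})=0$), and $f$ and $g$ identify the right-hand sides for $L_Y$ and $L_X$. Theorem. For every $Y\subset X$ we have $\tau(L_X)\ne 0$, the identification $\det R\Gamma(L_Y)=\det R\Gamma(L_X)$ just described exists and is uniquely determined, and with respect to it $$\frac{\tau(L_Y)}{\tau(L_X)}=\det\big((1-K)|_{\ell^2(X\setminus Y)}\big),$$ that is, $\tau(L_Y)=\det\big(\delta_{xy}-K(x,y)\big)_{x,y\in X\setminus Y}\cdot\tau(L_X)$. -/

import Mathlib

open scoped TensorProduct

noncomputable section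

namespace GapTau

/-! ### Rational functions, local rings of the projective line -/

/-- The field `ℂ(z)` of rational functions. -/
abbrev K : Type := RatFunc ℂ

/-- The rational function `z - x`. -/
def loc (x : ℂ) : K := RatFunc.X - RatFunc.C x

/-- The local ring of the affine line at `x`: rational functions that are regular at `x`. -/
def regular (x : ℂ) : Subalgebra ℂ K where
  carrier := {f | f.denom.eval x ≠ 0}
  mul_mem' := by
    intro f g hf hg h
    obtain ⟨c, hc⟩ := RatFunc.denom_mul_dvd f g
    have := congrArg (Polynomial.eval x) hc
    rw [Polynomial.eval_mul, Polynomial.eval_mul, h, zero_mul] at this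
    exact (mul_ne_zero hf hg) this
  add_mem' := by
    intro f g hf hg h
    obtain ⟨c, hc⟩ := RatFunc.denom_add_dvd f g
    have := congrArg (Polynomial.eval x) hc
    rw [Polynomial.eval_mul, Polynomial.eval_mul, h, zero_mul] at this
    exact (mul_ne_zero hf hg) this
  algebraMap_mem' := by
    intro c
    simp

/-- The value `f(x)`; meaningful when `f` is regular at `x`. -/
def value (x : ℂ) (f : K) : ℂ := f.eval (RingHom.id ℂ) x

theorem mem_regular {x : ℂ} {f : K} : f ∈ regular x ↔ f.denom.eval x ≠ 0 := Iff.rfl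

theorem value_add {x : ℂ} {f g : K} (hf : f ∈ regular x) (hg : g ∈ regular x) :
    value x (f + g) = value x f + value x g := RatFunc.eval_add (RingHom.id ℂ) x hf hg

theorem value_mul {x : ℂ} {f g : K} (hf : f ∈ regular x) (hg : g ∈ regular x) :
    value x (f * g) = value x f * value x g := RatFunc.eval_mul (RingHom.id ℂ) x hf hg

theorem C_mem (x c : ℂ) : RatFunc.C c ∈ regular x := by
  rw [← RatFunc.algebraMap_eq_C]; exact (regular x).algebraMap_mem c

theorem X_mem (x : ℂ) : (RatFunc.X : K) ∈ regular x := by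
  simp [mem_regular]

theorem loc_mem (x y : ℂ) : loc y ∈ regular x := sub_mem (X_mem x) (C_mem x y)

theorem value_C (x c : ℂ) : value x (RatFunc.C c) = c := by simp [value]

theorem value_zero (x : ℂ) : value x 0 = 0 := by simp [value]

theorem value_loc (x : ℂ) : value x (loc x) = 0 := by
  have h : loc x = RatFunc.X + RatFunc.C (-x) := by simp [loc, sub_eq_add_neg]
  rw [h, value_add (X_mem x) (C_mem x _), value_C]
  simp [value]

theorem smul_eq_C_mul (c : ℂ) (f : K) : c • f = RatFunc.C c * f := by
  rw [Algebra.smul_def, RatFunc.algebraMap_eq_C]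

theorem value_smul {x : ℂ} (c : ℂ) {f : K} (hf : f ∈ regular x) :
    value x (c • f) = c * value x f := by
  rw [smul_eq_C_mul, value_mul (C_mem x c) hf, value_C]

theorem value_sum {x : ℂ} {α : Type*} (t : Finset α) (f : α → K)
    (hf : ∀ a ∈ t, f a ∈ regular x) :
    value x (∑ a ∈ t, f a) = ∑ a ∈ t, value x (f a) := by
  classical
  induction t using Finset.induction_on with
  | empty => simp [value_zero]
  | insert a t ha ih =>
    rw [Finset.sum_insert ha, Finset.sum_insert ha,
      value_add (hf a (Finset.mem_insert_self a t))
        (sum_mem fun b hb => hf b (Finset.mem_insert_of_mem hb)),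
      ih fun b hb => hf b (Finset.mem_insert_of_mem hb)]

theorem loc_ne_zero (x : ℂ) : loc x ≠ 0 := by
  intro h
  have h2 : algebraMap (Polynomial ℂ) K (Polynomial.X - Polynomial.C x) = 0 := by
    simpa [loc] using h
  exact Polynomial.X_sub_C_ne_zero x
    ((map_eq_zero_iff _ (RatFunc.algebraMap_injective ℂ)).mp h2)

/-- If `(z - x) f` is regular at `x` and vanishes there, then `f` is regular at `x`. -/
theorem mem_of_loc_mul {x : ℂ} {f : K} (h : loc x * f ∈ regular x)
    (h0 : value x (loc x * f) = 0) : f ∈ regular x := by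
  set g := loc x * f with hg
  have hd : g.denom.eval x ≠ 0 := h
  have hn : g.num.eval x = 0 := by
    have h1 : g.num.eval x / g.denom.eval x = 0 := h0
    simpa [hd] using h1
  obtain ⟨u, hu⟩ := Polynomial.dvd_iff_isRoot.mpr hn
  have hl : loc x = algebraMap (Polynomial ℂ) K (Polynomial.X - Polynomial.C x) := by
    simp [loc]
  have hf : f = algebraMap _ K u / algebraMap _ K g.denom := by
    have h2 := RatFunc.num_div_denom g
    rw [hu, map_mul, ← hl, mul_div_assoc] at h2
    exact (mul_left_cancel₀ (loc_ne_zero x) (h2.trans hg)).symm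
  have hdvd : f.denom ∣ g.denom := by
    rw [hf]; exact RatFunc.denom_div_dvd _ _
  obtain ⟨c, hc⟩ := hdvd
  intro h3
  apply hd
  rw [hc, Polynomial.eval_mul, h3, zero_mul]

/-- Rational functions of degree at most `d`, i.e. sections of `𝒪(d)` near `∞`. -/
def degLE (d : ℤ) : Submodule ℂ K where
  carrier := {f | f = 0 ∨ f.intDegree ≤ d}
  zero_mem' := Or.inl rfl
  add_mem' := by
    rintro f g hf hg
    by_cases hg0 : g = 0
    · simpa [hg0] using hf
    by_cases hf0 : f = 0
    · simpa [hf0] using hg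
    by_cases h : f + g = 0
    · exact Or.inl h
    · refine Or.inr ((RatFunc.intDegree_add_le hg0 h).trans ?_)
      exact max_le (hf.resolve_left hf0) (hg.resolve_left hg0)
  smul_mem' := by
    intro c f hf
    by_cases hc : c = 0
    · exact Or.inl (by simp [hc])
    by_cases hf0 : f = 0
    · exact Or.inl (by simp [hf0])
    refine Or.inr ?_
    have hC : (RatFunc.C c : K) ≠ 0 := by simpa using hc
    rw [smul_eq_C_mul, RatFunc.intDegree_mul hC hf0, RatFunc.intDegree_C, zero_add]
    exact hf.resolve_left hf0

/-- The local ring (as a subspace of `ℂ(z)`) of `ℙ¹ = ℂ ∪ {∞}` at a point. -/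
def localRing (x : OnePoint ℂ) : Submodule ℂ K :=
  x.elim (degLE 0) fun z => Subalgebra.toSubmodule (regular z)

/-! ### Vector bundles on the projective line

A vector bundle of rank `|ι|`, with a trivialization of its generic fibre, is the family of its
local modules of sections, which are lattices in `ℂ(z)^ι` equal to the standard one at all but
finitely many points. Rational sections are the elements of `ℂ(z)^ι`. Two bundles with the same
`ι` are modifications of each other, through the identity of `ℂ(z)^ι`. -/

/-- A vector bundle on `ℙ¹` with generic fibre `ℂ(z)^ι`. -/
structure Bundle (ι : Type) where
  /-- the rational sections that are regular at a given point -/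
  stalk : OnePoint ℂ → Submodule ℂ (ι → K)
  locally_free : ∀ x, ∃ g : (ι → K) ≃ₗ[K] (ι → K),
    ∀ s, s ∈ stalk x ↔ ∀ i, g s i ∈ localRing x
  generically_standard :
    {x | stalk x ≠ Submodule.pi Set.univ fun _ => localRing x}.Finite

variable {ι : Type}

/-- Isomorphism of vector bundles. -/
def Bundle.Iso (L L' : Bundle ι) : Prop :=
  ∃ g : (ι → K) ≃ₗ[K] (ι → K), ∀ x s, s ∈ L.stalk x ↔ g s ∈ L'.stalk x

theorem mul_X_zpow_mem_degLE (d : ℤ) (f : K) :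
    RatFunc.X ^ (-d) * f ∈ degLE 0 ↔ f ∈ degLE d := by
  have hX : ∀ k : ℤ, (RatFunc.X ^ k : K).intDegree = k := by
    have hN : ∀ k : ℕ, (RatFunc.X ^ k : K).intDegree = k := by
      intro k
      induction k with
      | zero => simp
      | succ k ih =>
        rw [pow_succ, RatFunc.intDegree_mul (pow_ne_zero _ RatFunc.X_ne_zero) RatFunc.X_ne_zero,
          ih, RatFunc.intDegree_X]
        push_cast; ring
    intro k
    obtain ⟨k, rfl | rfl⟩ := k.eq_nat_or_neg
    · rw [zpow_natCast, hN]
    · rw [zpow_neg, zpow_natCast, RatFunc.intDegree_inv, hN]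
  by_cases hf : f = 0
  · simp [hf]
  have h0 : (RatFunc.X ^ (-d) : K) ≠ 0 := zpow_ne_zero _ RatFunc.X_ne_zero
  change (_ ∨ _) ↔ (_ ∨ _)
  rw [RatFunc.intDegree_mul h0 hf, hX]
  simp only [mul_eq_zero, h0, hf, false_or]
  constructor <;> intro h <;> linarith

/-- The bundle `⨁ᵢ 𝒪(dᵢ)`, where `𝒪(d)` is `𝒪(d · ∞)`. -/
def split (d : ι → ℤ) : Bundle ι where
  stalk x := x.elim (Submodule.pi Set.univ fun i => degLE (d i))
    fun z => Submodule.pi Set.univ fun _ => Subalgebra.toSubmodule (regular z)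
  locally_free := by
    intro x
    induction x with
    | infty =>
      refine ⟨LinearEquiv.piCongrRight fun i => LinearEquiv.smulOfNeZero K K
        (RatFunc.X ^ (-(d i))) (zpow_ne_zero _ RatFunc.X_ne_zero), fun s => ?_⟩
      simp only [OnePoint.elim_infty, Submodule.mem_pi, Set.mem_univ, true_imp_iff, localRing]
      exact forall_congr' fun i => (mul_X_zpow_mem_degLE (d i) (s i)).symm
    | coe z =>
      refine ⟨LinearEquiv.refl K _, fun s => ?_⟩
      simp [localRing, Submodule.mem_pi]
  generically_standard := by
    refine (Set.finite_singleton OnePoint.infty).subset fun x hx => ?_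
    induction x with
    | infty => rfl
    | coe z => exact absurd rfl hx

open Classical in
/-- The modification of `L` at a finite set `Y ⊆ ℂ` whose sections near `y ∈ Y` are given
by the lattice `M y`. -/
def Bundle.modify (L : Bundle ι) (Y : Finset ℂ) (M : ℂ → Submodule ℂ (ι → K))
    (hM : ∀ y ∈ Y, ∃ g : (ι → K) ≃ₗ[K] (ι → K), ∀ s, s ∈ M y ↔ ∀ i, g s i ∈ regular y) :
    Bundle ι where
  stalk x := x.elim (L.stalk OnePoint.infty) fun z => if z ∈ Y then M z else L.stalk z
  locally_free := by
    intro x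
    induction x with
    | infty => exact L.locally_free OnePoint.infty
    | coe z =>
      by_cases hz : z ∈ Y
      · simpa [hz, localRing] using hM z hz
      · simpa [hz] using L.locally_free z
  generically_standard := by
    refine (L.generically_standard.union (Y.finite_toSet.image OnePoint.some)).subset
      fun x hx => ?_
    induction x with
    | infty => exact Or.inl hx
    | coe z =>
      by_cases hz : z ∈ Y
      · exact Or.inr ⟨z, hz, rfl⟩
      · exact Or.inl (by simpa [hz] using hx)

/-! ### Cohomology -/

/-- Global sections. -/
def Bundle.H0 (L : Bundle ι) : Submodule ℂ (ι → K) := ⨅ x, L.stalk x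

/-- Rational sections that may have poles of any order at the points of `S`, and no others. -/
def Bundle.mero (L : Bundle ι) (S : Finset (OnePoint ℂ)) : Submodule ℂ (ι → K) :=
  ⨅ x, ⨅ (_ : x ∉ S), L.stalk x

/-- Polar parts of rational sections at the points of `S`. -/
abbrev Bundle.Polar (L : Bundle ι) (S : Finset (OnePoint ℂ)) : Type :=
  (x : S) → (ι → K) ⧸ L.stalk x

/-- The polar parts of a rational section. -/
def Bundle.toPolar (L : Bundle ι) (S : Finset (OnePoint ℂ)) : L.mero S →ₗ[ℂ] L.Polar S :=
  LinearMap.pi fun x => (L.stalk x).mkQ ∘ₗ (L.mero S).subtype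

/-- `H¹(ℙ¹, L)`, the obstruction space of the Mittag-Leffler problem with poles in the nonempty
finite set `S`: polar parts modulo those of rational sections. -/
abbrev Bundle.H1 (L : Bundle ι) (S : Finset (OnePoint ℂ)) : Type :=
  L.Polar S ⧸ LinearMap.range (L.toPolar S)

/-- For `L ⊆ L'` that differ at most at the points of `S`, the space of global sections
`H⁰(ℙ¹, L'/L)` of the torsion sheaf `L'/L`. -/
def Bundle.Quot (L L' : Bundle ι) (S : Finset (OnePoint ℂ)) : Type :=
  (x : S) → L'.stalk x ⧸ (L.stalk x).submoduleOf (L'.stalk x)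

instance (L L' : Bundle ι) (S : Finset (OnePoint ℂ)) : AddCommGroup (L.Quot L' S) :=
  inferInstanceAs (AddCommGroup
    ((x : S) → L'.stalk x ⧸ (L.stalk x).submoduleOf (L'.stalk x)))

instance (L L' : Bundle ι) (S : Finset (OnePoint ℂ)) : Module ℂ (L.Quot L' S) :=
  inferInstanceAs (Module ℂ
    ((x : S) → L'.stalk x ⧸ (L.stalk x).submoduleOf (L'.stalk x)))

/-- The component of a section of `L'/L` at a point. -/
def Bundle.Quot.proj (L L' : Bundle ι) (S : Finset (OnePoint ℂ)) (x : S) :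
    L.Quot L' S →ₗ[ℂ] L'.stalk x ⧸ (L.stalk x).submoduleOf (L'.stalk x) where
  toFun ξ := ξ x
  map_add' _ _ := rfl
  map_smul' _ _ := rfl

/-- The map `H⁰(L) → H⁰(L')` for `L ⊆ L'`. -/
def Bundle.inclH0 (L L' : Bundle ι) (h : ∀ x, L.stalk x ≤ L'.stalk x) :
    L.H0 →ₗ[ℂ] L'.H0 :=
  Submodule.inclusion (iInf_mono h)

/-- The map `H⁰(L') → H⁰(L'/L)`. -/
def Bundle.toQuot (L L' : Bundle ι) (S : Finset (OnePoint ℂ)) : L'.H0 →ₗ[ℂ] L.Quot L' S :=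
  { toFun := fun s x => ((L.stalk x).submoduleOf (L'.stalk x)).mkQ
      (Submodule.inclusion (iInf_le (fun x => L'.stalk x) x) s)
    map_add' := fun _ _ => rfl
    map_smul' := fun _ _ => rfl }

/-- The connecting map `H⁰(L'/L) → H¹(L)`. -/
def Bundle.connecting (L L' : Bundle ι) (S : Finset (OnePoint ℂ)) :
    L.Quot L' S →ₗ[ℂ] L.H1 S :=
  (LinearMap.range (L.toPolar S)).mkQ ∘ₗ LinearMap.pi fun x =>
    Submodule.mapQ ((L.stalk x).submoduleOf (L'.stalk x)) (L.stalk x) (L'.stalk x).subtype le_rfl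
      ∘ₗ Bundle.Quot.proj L L' S x

/-! ### Determinant lines and the `τ`-function -/

section Det

variable (V : Type) [AddCommGroup V] [Module ℂ V]

/-- The top exterior power of a finite-dimensional space. -/
abbrev DetLine : Type := ⋀[ℂ]^(Module.finrank ℂ V) V

variable {V}

/-- The canonical identification `det(0) = ℂ`. -/
def detLineZero (h : Module.finrank ℂ V = 0) : DetLine V ≃ₗ[ℂ] ℂ :=
  (LinearEquiv.ofEq _ _ (by rw [h])).trans (exteriorPower.zeroEquiv (R := ℂ) (M := V))

variable (V)

/-- The canonical element `1` of `det(V)` when `V = 0` (and `0` otherwise). -/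
def detOne : DetLine V :=
  if h : Module.finrank ℂ V = 0 then (detLineZero h).symm 1 else 0

/-- The canonical element `1` of `det(V)⁻¹` when `V = 0` (and `0` otherwise). -/
def detCoOne : Module.Dual ℂ (DetLine V) :=
  if h : Module.finrank ℂ V = 0 then (detLineZero h).toLinearMap else 0

variable {V} {W : Type} [AddCommGroup W] [Module ℂ W]

/-- The map `⋀ⁿ V ≃ ⋀ⁿ W` induced by `V ≃ W`. -/
def extPowCongr (n : ℕ) (h : V ≃ₗ[ℂ] W) : (⋀[ℂ]^n V) ≃ₗ[ℂ] (⋀[ℂ]^n W) :=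
  LinearEquiv.ofLinearMap (exteriorPower.map n h.toLinearMap)
    (exteriorPower.map n h.symm.toLinearMap)
    (by rw [← exteriorPower.map_comp, LinearEquiv.comp_coe, LinearEquiv.symm_trans_self,
      LinearEquiv.refl_toLinearMap, exteriorPower.map_id])
    (by rw [← exteriorPower.map_comp, LinearEquiv.comp_coe, LinearEquiv.self_trans_symm,
      LinearEquiv.refl_toLinearMap, exteriorPower.map_id])

/-- The isomorphism of determinant lines induced by an isomorphism of vector spaces. -/
def detCongr (h : V ≃ₗ[ℂ] W) : DetLine V ≃ₗ[ℂ] DetLine W :=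
  (extPowCongr (Module.finrank ℂ V) h).trans (LinearEquiv.ofEq _ _ (by rw [h.finrank_eq]))

/-- For an exact sequence `0 → A → B → C → D → 0` with maps `i, q, δ`, the assertion that `e` is the
canonical isomorphism `det A ⊗ (det D)⁻¹ ≃ det B ⊗ (det C)⁻¹`:

with `r = dim B - dim A = dim C - dim D` and `β ∈ ⋀ʳ B`, it sends `α ⊗ η` to `(i α ∧ β) ⊗ ε`, if
`ε` takes the value `η (δ γ)` at `q β ∧ γ` for every `γ ∈ ⋀^(dim D) C`. -/
def IsInducedDetIso {A B C D : Type} [AddCommGroup A] [Module ℂ A] [AddCommGroup B] [Module ℂ B]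
    [AddCommGroup C] [Module ℂ C] [AddCommGroup D] [Module ℂ D]
    (i : A →ₗ[ℂ] B) (q : B →ₗ[ℂ] C) (δ : C →ₗ[ℂ] D)
    (e : (DetLine A ⊗[ℂ] Module.Dual ℂ (DetLine D)) ≃ₗ[ℂ]
      (DetLine B ⊗[ℂ] Module.Dual ℂ (DetLine C))) : Prop :=
  ∀ r : ℕ, Module.finrank ℂ A + r = Module.finrank ℂ B →
  ∀ (α : DetLine A) (β : ⋀[ℂ]^r B) (ω : DetLine B)
    (η : Module.Dual ℂ (DetLine D)) (ε : Module.Dual ℂ (DetLine C)),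
    (ω : ExteriorAlgebra ℂ B) = ExteriorAlgebra.map i (α : ExteriorAlgebra ℂ A) * β →
    (∀ (γ : ⋀[ℂ]^(Module.finrank ℂ D) C) (θ : DetLine C),
      (θ : ExteriorAlgebra ℂ C) = ExteriorAlgebra.map q (β : ExteriorAlgebra ℂ B) * γ →
      ε θ = η (exteriorPower.map _ δ γ)) →
    e (α ⊗ₜ[ℂ] η) = ω ⊗ₜ[ℂ] ε

end Det

/-- `detRΓ(L) = det H⁰(L) ⊗ (det H¹(L))⁻¹`. -/
abbrev Bundle.DetRGamma (L : Bundle ι) (S : Finset (OnePoint ℂ)) : Type :=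
  DetLine L.H0 ⊗[ℂ] Module.Dual ℂ (DetLine (L.H1 S))

open Classical in
/-- `τ(L) ∈ detRΓ(L)⁻¹` is the canonical element `1` if `L ≃ ⨁ 𝒪(-1)` (in which case
`H⁰(L) = H¹(L) = 0` and `detRΓ(L) = ℂ`), and `0` otherwise. -/
def Bundle.tau (L : Bundle ι) (S : Finset (OnePoint ℂ)) : Module.Dual ℂ (L.DetRGamma S) :=
  if L.Iso (split fun _ => -1) then
    TensorProduct.dualDistrib ℂ _ _
      (detCoOne L.H0 ⊗ₜ[ℂ] Module.Dual.eval ℂ _ (detOne (L.H1 S)))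
  else 0

/-! ### The biorthogonal ensemble -/

/-- The data of a discrete biorthogonal ensemble: a finite phase space, two families of weight
functions without zeroes on it, and two multi-indices of equal weight. -/
structure Ensemble (p q : ℕ) where
  /-- the phase space -/
  X : Finset ℂ
  /-- the weights `ω_{1,i}` -/
  ω₁ : Fin p → ℂ → ℂ
  /-- the weights `ω_{2,j}` -/
  ω₂ : Fin q → ℂ → ℂ
  ω₁_ne_zero : ∀ i, ∀ x ∈ X, ω₁ i x ≠ 0
  ω₂_ne_zero : ∀ j, ∀ x ∈ X, ω₂ j x ≠ 0
  /-- the multi-index `(n_1, …, n_p)` -/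
  n : Fin p → ℕ
  /-- the multi-index `(m_1, …, m_q)` -/
  m : Fin q → ℕ
  sum_eq : ∑ i, n i = ∑ j, m j

namespace Ensemble

variable {p q : ℕ} (E : Ensemble p q)

/-- The number of particles. -/
def N : ℕ := ∑ i, E.n i

/-- The functions `ω_{1,i}(x) x^j`, `0 ≤ j < n_i`, enumerated lexicographically. -/
def φ (k : Fin E.N) (x : ℂ) : ℂ :=
  E.ω₁ (finSigmaFinEquiv.symm k).1 x * x ^ ((finSigmaFinEquiv.symm k).2 : ℕ)

/-- The functions `ω_{2,i}(x) x^j`, `0 ≤ j < m_i`, enumerated lexicographically. -/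
def ψ (k : Fin E.N) (x : ℂ) : ℂ :=
  E.ω₂ (finSigmaFinEquiv.symm (Fin.cast E.sum_eq k)).1 x *
    x ^ ((finSigmaFinEquiv.symm (Fin.cast E.sum_eq k)).2 : ℕ)

/-- The (unnormalized) weight of a configuration. -/
def F (x : Fin E.N → ℂ) : ℂ :=
  (Matrix.of fun i j => E.φ i (x j)).det * (Matrix.of fun i j => E.ψ i (x j)).det

/-- The partition function. -/
def Z : ℂ := ∑ x : Fin E.N → E.X, E.F fun k => (x k : ℂ)

/-- The Gram matrix `⟨φ_i, ψ_j⟩`. -/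
def gram : Matrix (Fin E.N) (Fin E.N) ℂ := Matrix.of fun i j => ∑ x ∈ E.X, E.φ i x * E.ψ j x

/-- The kernel `K(x,y) = ∑ M_{ij} φ_i(x) ψ_j(y)`, `M` the inverse transpose of the Gram matrix. -/
def kernel (x y : ℂ) : ℂ := ∑ i, ∑ j, (E.gram⁻¹).transpose i j * E.φ i x * E.ψ j y

/-- `det (1 - K)` on `ℓ²(T)`. -/
def fredholm (T : Finset ℂ) : ℂ :=
  (1 - Matrix.of fun x y : T => E.kernel x y).det

/-- Sections near `y` of the modification at `y`: `s_{1,i}` is regular, `s_{2,i}` has at most a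
simple pole, and `res_y s_{2,i} = - ω_{2,i}(y) ∑_j ω_{1,j}(y) s_{1,j}(y)`. -/
def modStalk (y : ℂ) : Submodule ℂ (Fin p ⊕ Fin q → K) where
  carrier := {s | (∀ i, s (.inl i) ∈ regular y) ∧ (∀ j, loc y * s (.inr j) ∈ regular y) ∧
    ∀ j, value y (loc y * s (.inr j)) = -(E.ω₂ j y * ∑ i, E.ω₁ i y * value y (s (.inl i)))}
  zero_mem' := by
    refine ⟨fun i => zero_mem _, fun j => ?_, fun j => ?_⟩
    · simp
    · simp [value_zero]
  add_mem' := by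
    rintro s t ⟨hs1, hs2, hs3⟩ ⟨ht1, ht2, ht3⟩
    refine ⟨fun i => add_mem (hs1 i) (ht1 i), fun j => ?_, fun j => ?_⟩
    · simpa [mul_add] using add_mem (hs2 j) (ht2 j)
    · simp only [Pi.add_apply, mul_add]
      rw [value_add (hs2 j) (ht2 j), hs3, ht3]
      simp only [value_add (hs1 _) (ht1 _), mul_add, Finset.sum_add_distrib]
      ring
  smul_mem' := by
    rintro c s ⟨hs1, hs2, hs3⟩
    refine ⟨fun i => Subalgebra.smul_mem _ (hs1 i) c, fun j => ?_, fun j => ?_⟩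
    · simpa using Subalgebra.smul_mem _ (hs2 j) c
    · simp only [Pi.smul_apply, mul_smul_comm]
      rw [value_smul c (hs2 j), hs3]
      simp only [value_smul c (hs1 _), mul_left_comm _ c, ← Finset.mul_sum]
      ring

theorem modStalk_free (y : ℂ) : ∃ g : (Fin p ⊕ Fin q → K) ≃ₗ[K] (Fin p ⊕ Fin q → K),
    ∀ s, s ∈ E.modStalk y ↔ ∀ i, g s i ∈ regular y := by
  let a : Fin q → (Fin p ⊕ Fin q → K) → K := fun j s =>
    RatFunc.C (E.ω₂ j y) * (∑ i, RatFunc.C (E.ω₁ i y) * s (.inl i)) / loc y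
  have ha_add : ∀ j s t, a j (s + t) = a j s + a j t := by
    intro j s t
    simp only [a, Pi.add_apply, mul_add, Finset.sum_add_distrib, add_div]
  have ha_smul : ∀ j (c : K) s, a j (c • s) = c * a j s := by
    intro j c s
    simp only [a, Pi.smul_apply, smul_eq_mul, mul_left_comm _ c, ← Finset.mul_sum, mul_div_assoc]
  have ha_inl : ∀ j s t, (∀ i, s (.inl i) = t (.inl i)) → a j s = a j t := by
    intro j s t h; simp only [a, h]
  refine ⟨{ toFun := fun s => Sum.elim (fun i => s (.inl i)) fun j => s (.inr j) + a j s
            invFun := fun s => Sum.elim (fun i => s (.inl i)) fun j => s (.inr j) - a j s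
            map_add' := ?_, map_smul' := ?_, left_inv := ?_, right_inv := ?_ }, ?_⟩
  · intro s t; ext k; rcases k with i | j
    · simp
    · simp [ha_add]; ring
  · intro c s; ext k; rcases k with i | j
    · simp
    · simp [ha_smul]; ring
  · intro s; ext k; rcases k with i | j
    · simp
    · simp only [Sum.elim_inr]
      rw [ha_inl j (Sum.elim (fun i => s (.inl i)) fun j => s (.inr j) + a j s) s (fun i => rfl)]
      ring
  · intro s; ext k; rcases k with i | j
    · simp
    · simp only [Sum.elim_inr]
      rw [ha_inl j (Sum.elim (fun i => s (.inl i)) fun j => s (.inr j) - a j s) s (fun i => rfl)]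
      ring
  · intro s
    have key : ∀ j, loc y * a j s =
        RatFunc.C (E.ω₂ j y) * ∑ i, RatFunc.C (E.ω₁ i y) * s (.inl i) := by
      intro j; simp only [a]; rw [mul_div_cancel₀ _ (loc_ne_zero y)]
    have kreg : (∀ i, s (.inl i) ∈ regular y) → ∀ j, loc y * a j s ∈ regular y := by
      intro h j; rw [key]
      exact mul_mem (C_mem _ _) (sum_mem fun i _ => mul_mem (C_mem _ _) (h i))
    have kval : (∀ i, s (.inl i) ∈ regular y) → ∀ j, value y (loc y * a j s) =
        E.ω₂ j y * ∑ i, E.ω₁ i y * value y (s (.inl i)) := by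
      intro h j
      rw [key, value_mul (C_mem _ _) (sum_mem fun i _ => mul_mem (C_mem _ _) (h i)), value_C,
        value_sum _ _ fun i _ => mul_mem (C_mem _ _) (h i)]
      congr 1
      exact Finset.sum_congr rfl fun i _ => by rw [value_mul (C_mem _ _) (h i), value_C]
    constructor
    · rintro ⟨h1, h2, h3⟩ (i | j)
      · exact h1 i
      · change s (.inr j) + a j s ∈ regular y
        refine mem_of_loc_mul (by rw [mul_add]; exact add_mem (h2 j) (kreg h1 j)) ?_
        rw [mul_add, value_add (h2 j) (kreg h1 j), h3, kval h1]
        ring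
    · intro h
      have h1 : ∀ i, s (.inl i) ∈ regular y := fun i => h (.inl i)
      have h2 : ∀ j, s (.inr j) + a j s ∈ regular y := fun j => h (.inr j)
      have e : ∀ j, loc y * s (.inr j) = loc y * (s (.inr j) + a j s) + (-1 : ℂ) • (loc y * a j s) :=
        fun j => by rw [neg_one_smul]; ring
      have h4 : ∀ j, loc y * (s (.inr j) + a j s) ∈ regular y := fun j =>
        mul_mem (loc_mem y y) (h2 j)
      have h5 : ∀ j, (-1 : ℂ) • (loc y * a j s) ∈ regular y := fun j =>
        Subalgebra.smul_mem _ (kreg h1 j) _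
      refine ⟨h1, fun j => ?_, fun j => ?_⟩
      · rw [e]; exact add_mem (h4 j) (h5 j)
      · rw [e, value_add (h4 j) (h5 j), value_mul (loc_mem y y) (h2 j), value_loc,
          value_smul _ (kreg h1 j), kval h1]
        ring

/-- The bundle `L_∅ = ⨁ᵢ 𝒪(nᵢ - 1) ⊕ ⨁ⱼ 𝒪(-mⱼ - 1)`. -/
def L₀ : Bundle (Fin p ⊕ Fin q) :=
  split (Sum.elim (fun i => (E.n i : ℤ) - 1) fun j => -(E.m j : ℤ) - 1)

/-- The modification `L_Y` of `L_∅` at the points of `Y`. -/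
def L (Y : Finset ℂ) : Bundle (Fin p ⊕ Fin q) :=
  E.L₀.modify Y E.modStalk fun y _ => E.modStalk_free y

/-- The vector `w_x = (0, …, 0; ω_{2,1}(x), …, ω_{2,q}(x))`. -/
def w (x : ℂ) : Fin p ⊕ Fin q → ℂ := Sum.elim (fun _ => 0) fun j => E.ω₂ j x

/-- The vector `w'_x = (ω_{1,1}(x), …, ω_{1,p}(x); 0, …, 0)`. -/
def w' (x : ℂ) : Fin p ⊕ Fin q → ℂ := Sum.elim (fun i => E.ω₁ i x) fun _ => 0

/-- The vector `w''_x = (0, …, 0; 1/ω_{2,1}(x), 0, …, 0)`. -/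
def w'' [NeZero q] (x : ℂ) : Fin p ⊕ Fin q → ℂ :=
  Sum.elim (fun _ => 0) fun j => if j = 0 then (E.ω₂ j x)⁻¹ else 0

/-- Sections near `x` of the upper modification at `x`: `s_{1,i}` is regular, `s_{2,i}` has at most
a simple pole, and `res_x s` is proportional to `w_x`. -/
def upStalk (x : ℂ) : Submodule ℂ (Fin p ⊕ Fin q → K) where
  carrier := {s | (∀ i, s (.inl i) ∈ regular x) ∧ (∀ j, loc x * s (.inr j) ∈ regular x) ∧
    ∃ c : ℂ, ∀ j, value x (loc x * s (.inr j)) = c * E.w x (.inr j)}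
  zero_mem' := by
    refine ⟨fun i => zero_mem _, fun k => ?_, 0, fun k => ?_⟩
    · simp
    · simp [value_zero]
  add_mem' := by
    rintro s t ⟨hs1, hs, c, hc⟩ ⟨ht1, ht, d, hd⟩
    refine ⟨fun i => add_mem (hs1 i) (ht1 i), fun k => ?_, c + d, fun k => ?_⟩
    · simpa [mul_add] using add_mem (hs k) (ht k)
    · simp only [Pi.add_apply, mul_add]
      rw [value_add (hs k) (ht k), hc, hd]; ring
  smul_mem' := by
    rintro a s ⟨hs1, hs, c, hc⟩
    refine ⟨fun i => Subalgebra.smul_mem _ (hs1 i) a, fun k => ?_, a * c, fun k => ?_⟩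
    · simpa using Subalgebra.smul_mem _ (hs k) a
    · simp only [Pi.smul_apply, mul_smul_comm]
      rw [value_smul a (hs k), hc]; ring

theorem upStalk_free [NeZero q] (x : ℂ) (hx : x ∈ E.X) :
    ∃ g : (Fin p ⊕ Fin q → K) ≃ₗ[K] (Fin p ⊕ Fin q → K),
      ∀ s, s ∈ E.upStalk x ↔ ∀ i, g s i ∈ regular x := by
  have hl := loc_ne_zero x
  have hw : E.ω₂ 0 x ≠ 0 := E.ω₂_ne_zero 0 x hx
  let r : Fin q → K := fun j => RatFunc.C (E.ω₂ j x / E.ω₂ 0 x)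
  refine ⟨{ toFun := fun s => Sum.elim (fun i => s (.inl i)) fun j =>
              if j = 0 then loc x * s (.inr 0) else s (.inr j) - r j * s (.inr 0)
            invFun := fun s => Sum.elim (fun i => s (.inl i)) fun j =>
              if j = 0 then s (.inr 0) / loc x else s (.inr j) + r j * (s (.inr 0) / loc x)
            map_add' := ?_, map_smul' := ?_, left_inv := ?_, right_inv := ?_ }, ?_⟩
  · intro s t; ext k; rcases k with i | j
    · simp
    · by_cases hj : j = 0
      · simp [hj, mul_add]
      · simp [hj, mul_add]; ring
  · intro c s; ext k; rcases k with i | j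
    · simp
    · by_cases hj : j = 0
      · simp [hj]; ring
      · simp [hj]; ring
  · intro s; ext k; rcases k with i | j
    · simp
    · by_cases hj : j = 0
      · simp [hj, hl]
      · simp [hj, hl]
  · intro s; ext k; rcases k with i | j
    · simp
    · by_cases hj : j = 0
      · simp [hj, mul_div_cancel₀ _ hl]
      · simp [hj]
  · intro s
    constructor
    · rintro ⟨h1, h2, c, hc⟩ (i | j)
      · exact h1 i
      · by_cases hj : j = 0
        · simpa [hj] using h2 0
        · have hgoal : s (.inr j) - r j * s (.inr 0) ∈ regular x := by
            have e : loc x * (s (.inr j) - r j * s (.inr 0)) =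
                loc x * s (.inr j) + (-(E.ω₂ j x / E.ω₂ 0 x)) • (loc x * s (.inr 0)) := by
              rw [smul_eq_C_mul, map_neg]; simp only [r]; ring
            refine mem_of_loc_mul ?_ ?_
            · rw [e]; exact add_mem (h2 j) (Subalgebra.smul_mem _ (h2 0) _)
            · rw [e, value_add (h2 j) (Subalgebra.smul_mem _ (h2 0) _), value_smul _ (h2 0), hc, hc]
              simp only [w, Sum.elim_inr]
              field_simp
              ring
          simpa [hj] using hgoal
    · intro h
      have h1 : ∀ i, s (.inl i) ∈ regular x := fun i => h (.inl i)
      have h0 : loc x * s (.inr 0) ∈ regular x := by simpa using h (.inr 0)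
      have h2 : ∀ j, j ≠ 0 → s (.inr j) - r j * s (.inr 0) ∈ regular x := fun j hj => by
        simpa [hj] using h (.inr j)
      have e : ∀ j, loc x * s (.inr j) = loc x * (s (.inr j) - r j * s (.inr 0)) +
          (E.ω₂ j x / E.ω₂ 0 x) • (loc x * s (.inr 0)) := by
        intro j; rw [smul_eq_C_mul]; simp only [r]; ring
      have h3 : ∀ j, j ≠ 0 → loc x * (s (.inr j) - r j * s (.inr 0)) ∈ regular x := fun j hj =>
        mul_mem (loc_mem x x) (h2 j hj)
      have h4 : ∀ j, (E.ω₂ j x / E.ω₂ 0 x) • (loc x * s (.inr 0)) ∈ regular x := fun j =>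
        Subalgebra.smul_mem _ h0 _
      refine ⟨h1, fun j => ?_, value x (loc x * s (.inr 0)) / E.ω₂ 0 x, fun j => ?_⟩
      · by_cases hj : j = 0
        · simpa [hj] using h0
        · rw [e]; exact add_mem (h3 j hj) (h4 j)
      · simp only [w, Sum.elim_inr]
        by_cases hj : j = 0
        · subst hj; field_simp
        · rw [e, value_add (h3 j hj) (h4 j), value_mul (loc_mem x x) (h2 j hj), value_loc,
            value_smul _ h0]
          ring

/-- The upper modification `L_Y^up` of `L_Y` at the points of `X - Y`. -/
def Lup [NeZero q] (Y : Finset ℂ) : Bundle (Fin p ⊕ Fin q) :=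
  (E.L Y).modify (E.X \ Y) E.upStalk fun x hx => E.upStalk_free x (Finset.mem_sdiff.mp hx).1

theorem modStalk_le (x : ℂ) : E.modStalk x ≤ E.upStalk x := by
  rintro s ⟨h1, h2, h3⟩
  refine ⟨h1, h2, -∑ i, E.ω₁ i x * value x (s (.inl i)), fun j => ?_⟩
  rw [h3]; simp only [w, Sum.elim_inr]; ring

theorem L_stalk_of_mem {Y : Finset ℂ} {x : ℂ} (hx : x ∈ Y) :
    (E.L Y).stalk x = E.modStalk x := if_pos hx

theorem L_stalk_of_notMem {Y : Finset ℂ} {x : ℂ} (hx : x ∉ Y) :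
    (E.L Y).stalk x = E.L₀.stalk x := if_neg hx

theorem Lup_stalk_of_mem [NeZero q] {Y : Finset ℂ} {x : ℂ} (hx : x ∈ E.X \ Y) :
    (E.Lup Y).stalk x = E.upStalk x := if_pos hx

theorem Lup_stalk_of_notMem [NeZero q] {Y : Finset ℂ} {x : ℂ} (hx : x ∉ E.X \ Y) :
    (E.Lup Y).stalk x = (E.L Y).stalk x := if_neg hx

theorem mem_L₀_stalk {x : ℂ} {s : Fin p ⊕ Fin q → K} :
    s ∈ E.L₀.stalk x ↔ ∀ k, s k ∈ regular x := by
  simp [L₀, split, Submodule.mem_pi]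

theorem value_loc_mul {x : ℂ} {f : K} (hf : f ∈ regular x) : value x (loc x * f) = 0 := by
  rw [value_mul (loc_mem x x) hf, value_loc, zero_mul]

/-- `L_Y ⊆ L_Y^up`. -/
theorem L_le_Lup [NeZero q] (Y : Finset ℂ) (x : OnePoint ℂ) : (E.L Y).stalk x ≤ (E.Lup Y).stalk x := by
  induction x with
  | infty => exact le_rfl
  | coe x =>
    by_cases hx : x ∈ E.X \ Y
    · rw [E.Lup_stalk_of_mem hx, E.L_stalk_of_notMem (Finset.mem_sdiff.mp hx).2]
      intro s hs
      rw [mem_L₀_stalk] at hs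
      refine ⟨fun i => hs _, fun j => mul_mem (loc_mem x x) (hs _), 0, fun j => ?_⟩
      rw [value_loc_mul (hs _), zero_mul]
    · rw [E.Lup_stalk_of_notMem hx]

/-- `L_X ⊆ L_Y^up` for `Y ⊆ X`. -/
theorem LX_le_Lup [NeZero q] {Y : Finset ℂ} (hY : Y ⊆ E.X) (x : OnePoint ℂ) :
    (E.L E.X).stalk x ≤ (E.Lup Y).stalk x := by
  induction x with
  | infty => exact le_rfl
  | coe x =>
    by_cases hx : x ∈ E.X \ Y
    · rw [E.Lup_stalk_of_mem hx, E.L_stalk_of_mem (Finset.mem_sdiff.mp hx).1]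
      exact E.modStalk_le x
    · rw [E.Lup_stalk_of_notMem hx]
      by_cases hxY : x ∈ Y
      · rw [E.L_stalk_of_mem hxY, E.L_stalk_of_mem (hY hxY)]
      · have hxX : x ∉ E.X := fun h => hx (Finset.mem_sdiff.mpr ⟨h, hxY⟩)
        rw [E.L_stalk_of_notMem hxY, E.L_stalk_of_notMem hxX]

/-- The function `(w'_x + w''_x (z - x)) s`. -/
def pairing [NeZero q] (x : ℂ) (s : Fin p ⊕ Fin q → K) : K :=
  ∑ k, (RatFunc.C (E.w' x k) + RatFunc.C (E.w'' x k) * loc x) * s k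

theorem pairing_eq [NeZero q] (x : ℂ) (s : Fin p ⊕ Fin q → K) :
    E.pairing x s = ∑ i, RatFunc.C (E.ω₁ i x) * s (.inl i) +
      RatFunc.C (E.ω₂ 0 x)⁻¹ * (loc x * s (.inr 0)) := by
  simp only [pairing, Fintype.sum_sum_type, w', w'', Sum.elim_inl, Sum.elim_inr, map_zero, zero_mul,
    add_zero, zero_add]
  congr 1
  rw [Finset.sum_eq_single 0]
  · simp [mul_assoc]
  · intro j _ hj; simp [hj]
  · simp

theorem value_pairing [NeZero q] {x : ℂ} {s : Fin p ⊕ Fin q → K} (hs : s ∈ E.upStalk x) :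
    value x (E.pairing x s) = ∑ i, E.ω₁ i x * value x (s (.inl i)) +
      (E.ω₂ 0 x)⁻¹ * value x (loc x * s (.inr 0)) := by
  obtain ⟨h1, h2, -⟩ := hs
  have h3 : ∀ i, RatFunc.C (E.ω₁ i x) * s (.inl i) ∈ regular x := fun i =>
    mul_mem (C_mem _ _) (h1 i)
  rw [pairing_eq, value_add (sum_mem fun i _ => h3 i) (mul_mem (C_mem _ _) (h2 0)),
    value_sum _ _ (fun i _ => h3 i), value_mul (C_mem _ _) (h2 0), value_C]
  congr 1
  exact Finset.sum_congr rfl fun i _ => by rw [value_mul (C_mem _ _) (h1 i), value_C]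

/-- The functional `f_x(s) = (w'_x + w''_x (z - x)) s |_{z = x}`. -/
def fAt [NeZero q] {Y : Finset ℂ} (x : ℂ) (hx : x ∈ E.X \ Y) : (E.Lup Y).stalk x →ₗ[ℂ] ℂ where
  toFun s := value x (E.pairing x s)
  map_add' := by
    rintro ⟨s, hs⟩ ⟨t, ht⟩
    rw [E.Lup_stalk_of_mem hx] at hs ht
    have hst := add_mem hs ht
    simp only [Submodule.coe_add]
    rw [E.value_pairing hst, E.value_pairing hs, E.value_pairing ht]
    simp only [Pi.add_apply, mul_add, value_add (hs.1 _) (ht.1 _), value_add (hs.2.1 _) (ht.2.1 _),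
      Finset.sum_add_distrib]
    ring
  map_smul' := by
    rintro c ⟨s, hs⟩
    rw [E.Lup_stalk_of_mem hx] at hs
    have hcs := (E.upStalk x).smul_mem c hs
    simp only [Submodule.coe_smul]
    rw [E.value_pairing hcs, E.value_pairing hs]
    simp only [Pi.smul_apply, mul_smul_comm, value_smul c (hs.1 _), value_smul c (hs.2.1 _),
      RingHom.id_apply, smul_eq_mul, mul_add, Finset.mul_sum, mul_left_comm _ c]

/-- The functional `g_x(s) = res_x s / w_x`, computed in the first of the components in which the
entries of `w_x` are nonzero. -/
def gAt [NeZero q] {Y : Finset ℂ} (x : ℂ) (hx : x ∈ E.X \ Y) : (E.Lup Y).stalk x →ₗ[ℂ] ℂ where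
  toFun s := value x (loc x * s.1 (.inr 0)) / E.w x (.inr 0)
  map_add' := by
    rintro ⟨s, hs⟩ ⟨t, ht⟩
    rw [E.Lup_stalk_of_mem hx] at hs ht
    simp only [Submodule.coe_add, Pi.add_apply, mul_add, value_add (hs.2.1 _) (ht.2.1 _), add_div]
  map_smul' := by
    rintro c ⟨s, hs⟩
    rw [E.Lup_stalk_of_mem hx] at hs
    simp only [Submodule.coe_smul, Pi.smul_apply, mul_smul_comm, value_smul c (hs.2.1 _),
      RingHom.id_apply, smul_eq_mul, mul_div_assoc]

/-- `f_{X-Y} : H⁰(L_Y^up / L_X) → ℂ^{X-Y}`. -/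
def fMap [NeZero q] (Y : Finset ℂ) (S : Finset (OnePoint ℂ)) (hS : ∀ x ∈ E.X, (x : OnePoint ℂ) ∈ S) :
    (E.L E.X).Quot (E.Lup Y) S →ₗ[ℂ] (↥(E.X \ Y) → ℂ) :=
  LinearMap.pi fun x =>
    Submodule.liftQ _ (E.fAt x.1 x.2) (by
      have hx := (Finset.mem_sdiff.mp x.2).1
      rintro ⟨s, hs'⟩ hs
      have hs : s ∈ E.modStalk x.1 := by
        rw [← E.L_stalk_of_mem hx]; exact hs
      have hw : E.ω₂ 0 x.1 ≠ 0 := E.ω₂_ne_zero 0 x.1 hx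
      change value x.1 (E.pairing x.1 s) = 0
      rw [E.value_pairing (E.modStalk_le x.1 hs), hs.2.2]
      field_simp
      ring)
    ∘ₗ Bundle.Quot.proj _ _ S (⟨(x.1 : OnePoint ℂ), hS x.1 (Finset.mem_sdiff.mp x.2).1⟩ : S)

/-- `g_{X-Y} : H⁰(L_Y^up / L_Y) → ℂ^{X-Y}`. -/
def gMap [NeZero q] (Y : Finset ℂ) (S : Finset (OnePoint ℂ)) (hS : ∀ x ∈ E.X, (x : OnePoint ℂ) ∈ S) :
    (E.L Y).Quot (E.Lup Y) S →ₗ[ℂ] (↥(E.X \ Y) → ℂ) :=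
  LinearMap.pi fun x =>
    Submodule.liftQ _ (E.gAt x.1 x.2) (by
      rintro ⟨s, hs'⟩ hs
      have hs : s ∈ E.L₀.stalk x.1 := by
        rw [← E.L_stalk_of_notMem (Finset.mem_sdiff.mp x.2).2]; exact hs
      rw [mem_L₀_stalk] at hs
      change value x.1 (loc x.1 * s (.inr 0)) / _ = 0
      rw [value_loc_mul (hs _), zero_div])
    ∘ₗ Bundle.Quot.proj _ _ S (⟨(x.1 : OnePoint ℂ), hS x.1 (Finset.mem_sdiff.mp x.2).1⟩ : S)

/-- `Φ` is the identification of `detRΓ(L_Y)` with `detRΓ(L_X)` by means of `(w_x, w'_x, w''_x)`,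
`x ∈ X - Y`, i.e. the composition
`detRΓ(L_Y) ≃ det H⁰(L_Y^up) ⊗ (det H⁰(L_Y^up/L_Y))⁻¹ ≃ det H⁰(L_Y^up) ⊗ (det H⁰(L_Y^up/L_X))⁻¹`
`≃ detRΓ(L_X)`, in which the outer isomorphisms are induced by the exact cohomology sequences of
`0 → L_Y → L_Y^up → L_Y^up/L_Y → 0` and `0 → L_X → L_Y^up → L_Y^up/L_X → 0`, and the one in the
middle by the isomorphisms `f_{X-Y}` and `g_{X-Y}` of both quotients with `ℂ^{X-Y}`. -/
def IsIdentification [NeZero q] {Y : Finset ℂ} (hY : Y ⊆ E.X) (S : Finset (OnePoint ℂ))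
    (hS : ∀ x ∈ E.X, (x : OnePoint ℂ) ∈ S)
    (Φ : (E.L Y).DetRGamma S ≃ₗ[ℂ] (E.L E.X).DetRGamma S) : Prop :=
  ∃ (eY : (E.L Y).DetRGamma S ≃ₗ[ℂ]
      (DetLine (E.Lup Y).H0 ⊗[ℂ] Module.Dual ℂ (DetLine ((E.L Y).Quot (E.Lup Y) S))))
    (eX : (E.L E.X).DetRGamma S ≃ₗ[ℂ]
      (DetLine (E.Lup Y).H0 ⊗[ℂ] Module.Dual ℂ (DetLine ((E.L E.X).Quot (E.Lup Y) S))))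
    (f : (E.L E.X).Quot (E.Lup Y) S ≃ₗ[ℂ] (↥(E.X \ Y) → ℂ))
    (g : (E.L Y).Quot (E.Lup Y) S ≃ₗ[ℂ] (↥(E.X \ Y) → ℂ)),
    IsInducedDetIso ((E.L Y).inclH0 (E.Lup Y) (E.L_le_Lup Y)) ((E.L Y).toQuot (E.Lup Y) S)
      ((E.L Y).connecting (E.Lup Y) S) eY ∧
    IsInducedDetIso ((E.L E.X).inclH0 (E.Lup Y) (E.LX_le_Lup hY)) ((E.L E.X).toQuot (E.Lup Y) S)
      ((E.L E.X).connecting (E.Lup Y) S) eX ∧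
    f.toLinearMap = E.fMap Y S hS ∧ g.toLinearMap = E.gMap Y S hS ∧
    Φ = eY ≪≫ₗ TensorProduct.congr (LinearEquiv.refl ℂ _) (detCongr (f ≪≫ₗ g.symm)).dualMap
      ≪≫ₗ eX.symm

end Ensemble

end GapTau

end

/-!
The cohomology of `L_Y` is computed by linear algebra on functions on `X`. A global section of the
upper modification `L_Y^up` consists of polynomials `s_{1,i}` of degree less than `n_i`, i.e. of a
function `F = ∑ ω_{1,i} s_{1,i}` in the span of the `φ_k`, and of rational functions `s_{2,j}` with
simple poles in `X`, whose residues are `R(x) ω_{2,j}(x)`, with `R = -F` on `Y`. By the residue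
theorem the condition at infinity on the `s_{2,j}` says that `∑_x R(x) ψ_l(x) = 0` for all `l`. In
terms of the coordinates `f = F + R` and `g = R` on `X - Y` this means that `F = K f`, so that
`g = (1 - K) f` (`Ensemble.gMap_toQuot_eq`).

By Andréief's identity `Z ≠ 0` means that the Gram matrix on `X` is invertible
(`Ensemble.Z_eq_factorial_mul_det`), and the Gram matrix on `Y` has determinant
`det(1 - K)|_{X - Y}` times that of `X` (`Ensemble.det_gramOn`). If the Gram matrix on `Y` is
invertible, then `L_Y(1)` has global sections with arbitrary leading coefficients at infinity. The
sections whose leading coefficients are the coordinate vectors form a matrix whose determinant is a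
rational function without poles on `ℂ`, equal to `1` at infinity, hence equal to `1`; so they are a
global frame, and `L_Y ≃ 𝒪(-1)^(p+q)` (`Ensemble.L_iso`). As `𝒪(-1)` has no cohomology
(`eq_zero_of_regular`, `exists_mittagLeffler`), this applies to `L_X`, shows that `f` is an
isomorphism from `H⁰(L_Y^up)` onto `ℂ^(X - Y)` and that `H¹(L_Y^up) = 0`. Conversely, if
`L_Y ≃ 𝒪(-1)^(p+q)`, then `g` is injective, so `det(1 - K) ≠ 0`.

The identification of the lines `detRΓ` exists and is unique because a four-term exact sequence
`0 → A → B → C → D → 0` determines an isomorphism of determinant lines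
(`existsUnique_isInducedDetIso`); this is reduced to the wedge product of generators of the
determinant lines in the short exact sequences from which it is spliced. If `det(1 - K) = 0`, then
both sides of the formula vanish. Otherwise `L_Y` and `L_X` have no cohomology, and the canonical
elements of their lines, mapped to `det H⁰(L_Y^up) ⊗ (det ℂ^(X - Y))⁻¹`, are given by the
isomorphisms `g` and `f`; they differ by the determinant of `g f⁻¹ = 1 - K`
(`inducedDetIso_detOne_eq_det_smul`).
-/

noncomputable section

namespace GapTau

/-! ### Determinant lines of exact sequences -/

section LinearAlgebra

open Module

variable {V W : Type} [AddCommGroup V] [Module ℂ V] [AddCommGroup W] [Module ℂ W]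

theorem coe_extPow_map (n : ℕ) (f : V →ₗ[ℂ] W) (x : ⋀[ℂ]^n V) :
    (exteriorPower.map n f x : ExteriorAlgebra ℂ W) = ExteriorAlgebra.map f x := by
  suffices h : (⋀[ℂ]^n W).subtype ∘ₗ exteriorPower.map n f =
      (ExteriorAlgebra.map f).toLinearMap ∘ₗ (⋀[ℂ]^n V).subtype from LinearMap.congr_fun h x
  refine exteriorPower.linearMap_ext ?_
  ext v
  simp [ExteriorAlgebra.map_apply_ιMulti]

/-- Vectors commute with homogeneous elements of the exterior algebra up to sign. -/
theorem mul_ι_eq_smul_ι_mul {n : ℕ} {α : ExteriorAlgebra ℂ V} (hα : α ∈ ⋀[ℂ]^n V) (v : V) :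
    α * ExteriorAlgebra.ι ℂ v = (-1 : ℂ) ^ n • (ExteriorAlgebra.ι ℂ v * α) := by
  induction hα using Submodule.pow_induction_on_left' with
  | algebraMap r => simp [Algebra.commutes]
  | add x y i hx hy ihx ihy => rw [add_mul, ihx, ihy, mul_add, smul_add]
  | mem_mul m hm i x hx ih =>
    obtain ⟨u, rfl⟩ := hm
    have h : ExteriorAlgebra.ι ℂ u * ExteriorAlgebra.ι ℂ v =
        -(ExteriorAlgebra.ι ℂ v * ExteriorAlgebra.ι ℂ u) :=
      eq_neg_of_add_eq_zero_left (ExteriorAlgebra.ι_add_mul_swap u v)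
    rw [mul_assoc, ih, mul_smul_comm, ← mul_assoc, h, pow_succ]
    simp [mul_assoc]

theorem map_mem_extPow {n : ℕ} (f : V →ₗ[ℂ] W) {x : ExteriorAlgebra ℂ V} (hx : x ∈ ⋀[ℂ]^n V) :
    ExteriorAlgebra.map f x ∈ ⋀[ℂ]^n W := by
  rw [← coe_extPow_map n f ⟨x, hx⟩]; exact (exteriorPower.map n f ⟨x, hx⟩).2

theorem mul_mem_extPow {m n : ℕ} {x y : ExteriorAlgebra ℂ V} (hx : x ∈ ⋀[ℂ]^m V)
    (hy : y ∈ ⋀[ℂ]^n V) : x * y ∈ ⋀[ℂ]^(m + n) V := by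
  change _ ∈ LinearMap.range (ExteriorAlgebra.ι ℂ) ^ (m + n)
  rw [pow_add]; exact Submodule.mul_mem_mul hx hy

theorem finrank_detLine [FiniteDimensional ℂ V] : finrank ℂ (DetLine V) = 1 := by
  rw [exteriorPower.finrank_eq, Nat.choose_self]

theorem detLine_mul_ι [FiniteDimensional ℂ V] (α : DetLine V) (v : V) :
    (α : ExteriorAlgebra ℂ V) * ExteriorAlgebra.ι ℂ v = 0 := by
  have h : (α : ExteriorAlgebra ℂ V) * ExteriorAlgebra.ι ℂ v ∈ ⋀[ℂ]^(finrank ℂ V + 1) V :=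
    mul_mem_extPow α.2 (by
      change _ ∈ LinearMap.range (ExteriorAlgebra.ι ℂ) ^ 1
      rw [pow_one]; exact ⟨v, rfl⟩)
  have h0 : finrank ℂ (⋀[ℂ]^(finrank ℂ V + 1) V) = 0 := by
    rw [exteriorPower.finrank_eq, Nat.choose_eq_zero_of_lt (Nat.lt_succ_self _)]
  have : Subsingleton (⋀[ℂ]^(finrank ℂ V + 1) V) := finrank_zero_iff.mp h0
  exact congrArg Subtype.val (Subsingleton.elim (⟨_, h⟩ : ⋀[ℂ]^(finrank ℂ V + 1) V) 0)

/-- The wedge product with the image of a top-degree element of `A` only sees the other factor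
modulo `A`. -/
theorem map_mul_eq_map_mul_map [FiniteDimensional ℂ V] (i : V →ₗ[ℂ] W) (α : DetLine V)
    (φ : W →ₗ[ℂ] W) (hφ : ∀ w, w - φ w ∈ LinearMap.range i) {r : ℕ} {β : ExteriorAlgebra ℂ W}
    (hβ : β ∈ ⋀[ℂ]^r W) :
    ExteriorAlgebra.map i α * β = ExteriorAlgebra.map i α * ExteriorAlgebra.map φ β := by
  induction hβ using Submodule.pow_induction_on_left' with
  | algebraMap r => simp
  | add x y i hx hy ihx ihy => rw [mul_add, ihx, ihy, map_add, mul_add]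
  | mem_mul m hm k x hx ih =>
    obtain ⟨w, rfl⟩ := hm
    obtain ⟨v, hv⟩ := hφ w
    have h1 : ExteriorAlgebra.map i α * ExteriorAlgebra.ι ℂ w =
        ExteriorAlgebra.map i α * ExteriorAlgebra.ι ℂ (φ w) := by
      rw [← sub_eq_zero, ← mul_sub, ← map_sub, ← hv, ← ExteriorAlgebra.map_apply_ι, ← map_mul,
        detLine_mul_ι, map_zero]
    rw [← mul_assoc, h1, map_mul, ExteriorAlgebra.map_apply_ι, ← mul_assoc,
      mul_ι_eq_smul_ι_mul (map_mem_extPow i α.2), smul_mul_assoc, smul_mul_assoc, mul_assoc, ih,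
      mul_assoc]

theorem ιMulti_basis_ne_zero {n : ℕ} (b : Basis (Fin n) ℂ V) :
    ExteriorAlgebra.ιMulti ℂ n b ≠ 0 := by
  intro h
  have h1 : exteriorPower.ιMulti ℂ n b = 0 := Subtype.ext h
  have h2 := exteriorPower.alternatingMapLinearEquiv_apply_ιMulti b.det b
  rw [h1, map_zero, b.det_self] at h2
  exact zero_ne_one h2

theorem exists_smul_ιMulti_basis [FiniteDimensional ℂ V] (α : DetLine V) :
    ∃ c : ℂ, (α : ExteriorAlgebra ℂ V) = c • ExteriorAlgebra.ιMulti ℂ _ (finBasis ℂ V) := by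
  have h : exteriorPower.ιMulti ℂ _ (finBasis ℂ V) ≠ 0 := fun h =>
    ιMulti_basis_ne_zero _ (congrArg Subtype.val h)
  obtain ⟨c, hc⟩ := (finrank_eq_one_iff_of_nonzero' _ h).mp finrank_detLine α
  exact ⟨c, by rw [← hc]; rfl⟩

theorem map_det_eq_smul [FiniteDimensional ℂ V] (u : V →ₗ[ℂ] V) (β : DetLine V) :
    exteriorPower.map _ u β = LinearMap.det u • β := by
  set b := finBasis ℂ V
  obtain ⟨c, hc⟩ := exists_smul_ιMulti_basis β
  have hβ : β = c • exteriorPower.ιMulti ℂ _ b := Subtype.ext hc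
  have h0 : exteriorPower.ιMulti ℂ _ b ≠ 0 := fun h =>
    ιMulti_basis_ne_zero _ (congrArg Subtype.val h)
  obtain ⟨d, hd⟩ := (finrank_eq_one_iff_of_nonzero' _ h0).mp finrank_detLine
    (exteriorPower.ιMulti ℂ _ (u ∘ b))
  have h1 := congrArg (exteriorPower.alternatingMapLinearEquiv b.det) hd
  rw [map_smul, exteriorPower.alternatingMapLinearEquiv_apply_ιMulti,
    exteriorPower.alternatingMapLinearEquiv_apply_ιMulti, b.det_comp, b.det_self] at h1
  simp only [smul_eq_mul, mul_one] at h1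
  rw [hβ, map_smul, exteriorPower.map_apply_ιMulti, ← hd, h1, smul_comm]

/-- For a split short exact sequence the wedge product of generators of the determinant lines of
the outer terms is a generator of the one in the middle. -/
theorem map_mul_map_ne_zero {U : Type} [AddCommGroup U] [Module ℂ U] [FiniteDimensional ℂ U]
    [FiniteDimensional ℂ V] [FiniteDimensional ℂ W] {i : V →ₗ[ℂ] W} {ρ : W →ₗ[ℂ] U}
    {σ : U →ₗ[ℂ] W} (hi : Function.Injective i) (hex : Function.Exact i ρ)
    (hσ : ρ ∘ₗ σ = LinearMap.id) {α : DetLine V} (hα : α ≠ 0) {κ : DetLine U} (hκ : κ ≠ 0) :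
    ExteriorAlgebra.map i α * ExteriorAlgebra.map σ κ ≠ 0 := by
  obtain ⟨c, hc⟩ := exists_smul_ιMulti_basis α
  obtain ⟨d, hd⟩ := exists_smul_ιMulti_basis κ
  have hc0 : c ≠ 0 := by rintro rfl; exact hα (Subtype.ext (by simpa using hc))
  have hd0 : d ≠ 0 := by rintro rfl; exact hκ (Subtype.ext (by simpa using hd))
  have hσ' : ∀ x, ρ (σ x) = x := LinearMap.congr_fun hσ
  have hρ : Function.Surjective ρ := fun x => ⟨σ x, hσ' x⟩
  have hli : LinearIndependent ℂ (Fin.append (i ∘ finBasis ℂ V) (σ ∘ finBasis ℂ U)) := by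
    have h1 : LinearIndependent ℂ (Sum.elim (i ∘ finBasis ℂ V) (σ ∘ finBasis ℂ U)) := by
      refine LinearIndependent.sum_type
        ((finBasis ℂ V).linearIndependent.map' i (LinearMap.ker_eq_bot.mpr hi))
        ((finBasis ℂ U).linearIndependent.map' σ (LinearMap.ker_eq_bot.mpr
          (Function.LeftInverse.injective hσ'))) ?_
      rw [Set.range_comp, Set.range_comp, Submodule.span_image, Submodule.span_image,
        Submodule.disjoint_def]
      rintro _ ⟨v, -, rfl⟩ ⟨u, -, hu⟩
      have h2 := congrArg ρ hu
      rw [hσ', hex.apply_apply_eq_zero] at h2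
      rw [← hu, h2, map_zero]
    convert h1.comp _ finSumFinEquiv.symm.injective using 1
    ext k
    refine Fin.addCases (fun k => ?_) (fun k => ?_) k <;> simp
  rw [hc, hd, map_smul, map_smul, ExteriorAlgebra.map_apply_ιMulti,
    ExteriorAlgebra.map_apply_ιMulti, smul_mul_smul_comm, ExteriorAlgebra.ιMulti_mul_ιMulti]
  refine smul_ne_zero (mul_ne_zero hc0 hd0) ?_
  have hdim : finrank ℂ V + finrank ℂ U = finrank ℂ W := by
    have := LinearMap.finrank_range_add_finrank_ker ρ
    rw [LinearMap.range_eq_top.mpr hρ, finrank_top, hex.linearMap_ker_eq,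
      LinearMap.finrank_range_of_inj hi] at this
    omega
  have hb := ιMulti_basis_ne_zero
    (basisOfLinearIndependentOfCardEqFinrank' _ hli (by simpa using hdim))
  simpa using hb

theorem exists_linearEquiv_apply_eq (hV : finrank ℂ V = 1) (hW : finrank ℂ W = 1) {x : V}
    (hx : x ≠ 0) {y : W} (hy : y ≠ 0) : ∃ e : V ≃ₗ[ℂ] W, e x = y := by
  have hx' := (finrank_eq_one_iff_of_nonzero x hx).mp hV
  have hy' := (finrank_eq_one_iff_of_nonzero y hy).mp hW
  refine ⟨(LinearEquiv.ofTop _ hx').symm ≪≫ₗ (LinearEquiv.toSpanNonzeroSingleton ℂ V x hx).symm ≪≫ₗ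
    LinearEquiv.toSpanNonzeroSingleton ℂ W y hy ≪≫ₗ LinearEquiv.ofTop _ hy', ?_⟩
  have h : (LinearEquiv.ofTop _ hx').symm x = LinearEquiv.toSpanNonzeroSingleton ℂ V x hx 1 :=
    Subtype.ext (by simp)
  simp only [LinearEquiv.trans_apply]
  rw [h, LinearEquiv.symm_apply_apply]
  simp

theorem exists_dual_apply_eq_one {x : V} (hx : x ≠ 0) : ∃ η : Dual ℂ V, η x = 1 := by
  obtain ⟨f, hf⟩ := not_forall.mp (mt (forall_dual_apply_eq_zero_iff ℂ x).mp hx)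
  exact ⟨(f x)⁻¹ • f, by simp [inv_mul_cancel₀ hf]⟩

theorem tmul_ne_zero {x : V} (hx : x ≠ 0) {y : W} (hy : y ≠ 0) : x ⊗ₜ[ℂ] y ≠ 0 := by
  obtain ⟨f, hf⟩ := exists_dual_apply_eq_one hx
  obtain ⟨g, hg⟩ := exists_dual_apply_eq_one hy
  intro h
  have := congrArg (TensorProduct.dualDistrib ℂ V W (f ⊗ₜ[ℂ] g)) h
  simp [hf, hg] at this

theorem linearEquiv_eq_of_apply_eq (hV : finrank ℂ V = 1) {x : V} (hx : x ≠ 0)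
    {e e' : V ≃ₗ[ℂ] W} (h : e x = e' x) : e = e' := by
  ext y
  obtain ⟨c, rfl⟩ := (finrank_eq_one_iff_of_nonzero' x hx).mp hV y
  rw [map_smul, map_smul, h]

/-! ### The isomorphism of determinant lines of a four-term exact sequence -/

theorem finrank_dual_detLine [FiniteDimensional ℂ V] : finrank ℂ (Dual ℂ (DetLine V)) = 1 := by
  rw [Subspace.dual_finrank_eq, finrank_detLine]

theorem exists_detLine_ne_zero [FiniteDimensional ℂ V] : ∃ x : DetLine V, x ≠ 0 := by
  have : Nontrivial (DetLine V) :=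
    nontrivial_of_finrank_pos (R := ℂ) (by rw [finrank_detLine]; exact one_pos)
  exact exists_ne 0

theorem eq_smul_of_apply_eq_one [FiniteDimensional ℂ V] {x : DetLine V}
    {η : Dual ℂ (DetLine V)} (h : η x = 1) (ε : Dual ℂ (DetLine V)) : ε = ε x • η := by
  have hx : x ≠ 0 := by rintro rfl; simp at h
  refine LinearMap.ext fun y => ?_
  obtain ⟨c, rfl⟩ := (finrank_eq_one_iff_of_nonzero' x hx).mp finrank_detLine y
  simp [h, mul_comm]

/-- A four-term exact sequence of finite-dimensional spaces induces an isomorphism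
`det A ⊗ (det D)⁻¹ ≃ det B ⊗ (det C)⁻¹`, and it is the only one with the property that defines it:
both sides are lines, and the property prescribes the image of a generator. -/
theorem existsUnique_isInducedDetIso {A B C D : Type} [AddCommGroup A] [Module ℂ A]
    [AddCommGroup B] [Module ℂ B] [AddCommGroup C] [Module ℂ C] [AddCommGroup D] [Module ℂ D]
    [FiniteDimensional ℂ A] [FiniteDimensional ℂ B] [FiniteDimensional ℂ C]
    [FiniteDimensional ℂ D] {i : A →ₗ[ℂ] B} {q : B →ₗ[ℂ] C} {δ : C →ₗ[ℂ] D}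
    (hi : Function.Injective i) (hiq : Function.Exact i q) (hqδ : Function.Exact q δ)
    (hδ : Function.Surjective δ) : ∃! e, IsInducedDetIso i q δ e := by
  set R := LinearMap.range q
  -- The sequence is spliced from `0 → A → B → R → 0` and `0 → R → C → D → 0`.
  set ρ : B →ₗ[ℂ] R := q.rangeRestrict with hρdef
  obtain ⟨σ, hσ⟩ := ρ.exists_rightInverse_of_surjective q.range_rangeRestrict
  obtain ⟨σ', hσ'⟩ := δ.exists_rightInverse_of_surjective (LinearMap.range_eq_top.mpr hδ)
  have hex : Function.Exact i ρ := fun b => by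
    rw [← hiq b, hρdef, ← Subtype.coe_inj]; rfl
  have hex' : Function.Exact R.subtype δ := fun c => by
    rw [hqδ c]; simp [R]
  have hRB : finrank ℂ A + finrank ℂ R = finrank ℂ B := by
    have := LinearMap.finrank_range_add_finrank_ker q
    rw [hiq.linearMap_ker_eq, LinearMap.finrank_range_of_inj hi] at this
    rw [add_comm]; exact this
  have hRC : finrank ℂ R + finrank ℂ D = finrank ℂ C := by
    have := LinearMap.finrank_range_add_finrank_ker δ
    rw [hqδ.linearMap_ker_eq, LinearMap.range_eq_top.mpr hδ, finrank_top] at this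
    rw [add_comm]; exact this
  obtain ⟨α₀, hα₀⟩ := exists_detLine_ne_zero (V := A)
  obtain ⟨κ, hκ⟩ := exists_detLine_ne_zero (V := R)
  obtain ⟨d₀, hd₀⟩ := exists_detLine_ne_zero (V := D)
  obtain ⟨η₀, hη₀⟩ := exists_dual_apply_eq_one hd₀
  set β₀ := exteriorPower.map _ σ κ with hβ₀
  set γ₀ := exteriorPower.map _ σ' d₀ with hγ₀
  obtain ⟨ω₀, hω₀⟩ : ∃ ω : DetLine B, (ω : ExteriorAlgebra ℂ B) =
      ExteriorAlgebra.map i α₀ * β₀ :=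
    ⟨⟨_, hRB ▸ mul_mem_extPow (map_mem_extPow i α₀.2) β₀.2⟩, rfl⟩
  obtain ⟨θ₀, hθ₀⟩ : ∃ θ : DetLine C, (θ : ExteriorAlgebra ℂ C) =
      ExteriorAlgebra.map R.subtype κ * γ₀ :=
    ⟨⟨_, hRC ▸ mul_mem_extPow (map_mem_extPow _ κ.2) γ₀.2⟩, rfl⟩
  have hω₀' : ω₀ ≠ 0 := by
    rintro rfl
    exact map_mul_map_ne_zero hi hex hσ hα₀ hκ (by rw [← coe_extPow_map _ σ, ← hβ₀, ← hω₀]; rfl)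
  have hθ₀' : θ₀ ≠ 0 := by
    rintro rfl
    exact map_mul_map_ne_zero R.injective_subtype hex' hσ' hκ hd₀
      (by rw [← coe_extPow_map _ σ', ← hγ₀, ← hθ₀]; rfl)
  obtain ⟨ε₀, hε₀⟩ := exists_dual_apply_eq_one hθ₀'
  have hη₀' : η₀ ≠ 0 := by rintro rfl; simp at hη₀
  have hε₀' : ε₀ ≠ 0 := by rintro rfl; simp at hε₀
  have hdimL : finrank ℂ (DetLine A ⊗[ℂ] Dual ℂ (DetLine D)) = 1 := by
    rw [finrank_tensorProduct, finrank_detLine, finrank_dual_detLine]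
  have hdimR : finrank ℂ (DetLine B ⊗[ℂ] Dual ℂ (DetLine C)) = 1 := by
    rw [finrank_tensorProduct, finrank_detLine, finrank_dual_detLine]
  have hL0 : α₀ ⊗ₜ[ℂ] η₀ ≠ 0 := tmul_ne_zero hα₀ hη₀'
  have hR0 : ω₀ ⊗ₜ[ℂ] ε₀ ≠ 0 := tmul_ne_zero hω₀' hε₀'
  obtain ⟨e, he⟩ := exists_linearEquiv_apply_eq (V := DetLine A ⊗[ℂ] Dual ℂ (DetLine D))
    (W := DetLine B ⊗[ℂ] Dual ℂ (DetLine C)) hdimL hdimR hL0 hR0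
  have hqσ : ExteriorAlgebra.map q (β₀ : ExteriorAlgebra ℂ B) =
      ExteriorAlgebra.map R.subtype (κ : ExteriorAlgebra ℂ R) := by
    have : q = R.subtype ∘ₗ ρ := rfl
    rw [← coe_extPow_map, ← coe_extPow_map, hβ₀, this, exteriorPower.map_comp,
      LinearMap.comp_apply, ← LinearMap.comp_apply (exteriorPower.map _ ρ),
      ← exteriorPower.map_comp, hσ, exteriorPower.map_id, LinearMap.id_apply]
  -- `β` enters only through the multiple `c` of `κ` to which it is mapped in `det R`; this factor
  -- appears in `ω` and, inverted, in `ε`.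
  refine ⟨e, ?_, fun e' he' => ?_⟩
  · intro r hr α β ω η ε hω hε
    obtain rfl : r = finrank ℂ R := by omega
    obtain ⟨a, rfl⟩ := (finrank_eq_one_iff_of_nonzero' _ hα₀).mp finrank_detLine α
    obtain ⟨c, hc⟩ := (finrank_eq_one_iff_of_nonzero' _ hκ).mp finrank_detLine
      (exteriorPower.map _ ρ β)
    have hηη := eq_smul_of_apply_eq_one hη₀ η
    have hεε := eq_smul_of_apply_eq_one hε₀ ε
    have hωω : ω = (a * c) • ω₀ := by
      refine Subtype.ext ?_
      rw [hω, map_mul_eq_map_mul_map i _ (σ ∘ₗ ρ) (fun w => ?_) β.2, ← coe_extPow_map _ (σ ∘ₗ ρ),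
        exteriorPower.map_comp, LinearMap.comp_apply, ← hc, map_smul]
      · simp [hω₀, hβ₀, mul_smul, smul_comm a c]
      · rw [← hex.linearMap_ker_eq, LinearMap.mem_ker, map_sub, LinearMap.comp_apply,
          show ρ (σ (ρ w)) = ρ w from LinearMap.congr_fun hσ _, sub_self]
    have hqβ : ExteriorAlgebra.map q (β : ExteriorAlgebra ℂ B) =
        c • ExteriorAlgebra.map R.subtype (κ : ExteriorAlgebra ℂ R) := by
      have : q = R.subtype ∘ₗ ρ := rfl
      rw [← coe_extPow_map, ← coe_extPow_map, this, exteriorPower.map_comp,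
        LinearMap.comp_apply, ← hc, map_smul]; rfl
    have hval : ε θ₀ * c = η d₀ := by
      have h := hε γ₀ (c • θ₀) (by rw [hqβ, smul_mul_assoc, ← hθ₀]; rfl)
      rw [hγ₀, ← LinearMap.comp_apply (exteriorPower.map _ δ), ← exteriorPower.map_comp, hσ',
        exteriorPower.map_id, LinearMap.id_apply, map_smul] at h
      rw [← h, smul_eq_mul, mul_comm]
    rw [hηη, hεε, hωω, TensorProduct.smul_tmul_smul, TensorProduct.smul_tmul_smul, map_smul, he,
      ← hval]
    congr 1; ring
  · have h : e' (α₀ ⊗ₜ[ℂ] η₀) = ω₀ ⊗ₜ[ℂ] ε₀ := by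
      refine he' _ hRB α₀ β₀ ω₀ η₀ ε₀ hω₀ fun γ θ hθ => ?_
      obtain ⟨c, hc⟩ := (finrank_eq_one_iff_of_nonzero' _ hd₀).mp finrank_detLine
        (exteriorPower.map _ δ γ)
      have hθθ : θ = c • θ₀ := by
        refine Subtype.ext ?_
        rw [hθ, hqσ, map_mul_eq_map_mul_map R.subtype _ (σ' ∘ₗ δ) (fun w => ?_) γ.2,
          ← coe_extPow_map _ (σ' ∘ₗ δ), exteriorPower.map_comp, LinearMap.comp_apply, ← hc,
          map_smul]
        · simp [hθ₀, hγ₀]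
        · rw [← hex'.linearMap_ker_eq, LinearMap.mem_ker, map_sub, LinearMap.comp_apply,
            show δ (σ' (δ w)) = δ w from LinearMap.congr_fun hσ' _, sub_self]
      rw [hθθ, ← hc, map_smul, map_smul, hε₀, hη₀]
    exact linearEquiv_eq_of_apply_eq (V := DetLine A ⊗[ℂ] Dual ℂ (DetLine D))
      (W := DetLine B ⊗[ℂ] Dual ℂ (DetLine C)) hdimL hL0 (h.trans he.symm)

/-! ### Determinant lines of zero spaces -/

theorem exists_coe_eq_algebraMap {n : ℕ} (hn : n = 0) (γ : ⋀[ℂ]^n V) :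
    ∃ c : ℂ, (γ : ExteriorAlgebra ℂ V) = algebraMap ℂ _ c := by
  subst hn
  obtain ⟨x, hx⟩ := γ
  change x ∈ LinearMap.range (ExteriorAlgebra.ι ℂ) ^ 0 at hx
  rw [pow_zero, Submodule.mem_one] at hx
  obtain ⟨c, hc⟩ := hx
  exact ⟨c, hc.symm⟩

theorem coe_ofEq_zeroEquiv_symm {n : ℕ} (hn : n = 0)
    (h : (⋀[ℂ]^n V) = (⋀[ℂ]^0 V)) :
    ((((LinearEquiv.ofEq _ _ h).trans (exteriorPower.zeroEquiv (R := ℂ) (M := V))).symm 1 :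
      ⋀[ℂ]^n V) : ExteriorAlgebra ℂ V) = 1 := by
  subst hn
  simp [exteriorPower.zeroEquiv]

theorem coe_detOne (h : finrank ℂ V = 0) : (detOne V : ExteriorAlgebra ℂ V) = 1 := by
  rw [detOne, dif_pos h]
  exact coe_ofEq_zeroEquiv_symm h _

theorem detCoOne_detOne (h : finrank ℂ V = 0) : detCoOne V (detOne V) = 1 := by
  rw [detOne, detCoOne, dif_pos h, dif_pos h]
  simp

/-- When the outer terms of `0 → A → B → C → D → 0` vanish, the canonical isomorphism
`ℂ ≃ det B ⊗ (det C)⁻¹` is given by `B ≃ C`. -/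
theorem IsInducedDetIso.apply_detOne {A B C D : Type} [AddCommGroup A] [Module ℂ A]
    [AddCommGroup B] [Module ℂ B] [AddCommGroup C] [Module ℂ C] [AddCommGroup D] [Module ℂ D]
    {i : A →ₗ[ℂ] B} {q : B →ₗ[ℂ] C} {δ : C →ₗ[ℂ] D}
    {e : (DetLine A ⊗[ℂ] Dual ℂ (DetLine D)) ≃ₗ[ℂ] (DetLine B ⊗[ℂ] Dual ℂ (DetLine C))}
    (he : IsInducedDetIso i q δ e) (hA : finrank ℂ A = 0) (hD : finrank ℂ D = 0)
    {β : DetLine B} {θ₁ : DetLine C}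
    (hθ₁ : (θ₁ : ExteriorAlgebra ℂ C) = ExteriorAlgebra.map q (β : ExteriorAlgebra ℂ B))
    {ε : Dual ℂ (DetLine C)} (hε : ε θ₁ = 1) :
    e (detOne A ⊗ₜ[ℂ] detCoOne D) = β ⊗ₜ[ℂ] ε := by
  refine he _ (by rw [hA, zero_add]) (detOne A) β β (detCoOne D) ε ?_ fun γ θ hθ => ?_
  · rw [coe_detOne hA, map_one, one_mul]
  · obtain ⟨c, hc⟩ := exists_coe_eq_algebraMap hD γ
    have h1 : θ = c • θ₁ := Subtype.ext (by
      rw [hθ, hc, ← Algebra.commutes, ← Algebra.smul_def, ← hθ₁]; rfl)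
    have h2 : exteriorPower.map _ δ γ = c • detOne D := Subtype.ext (by
      rw [coe_extPow_map, hc, AlgHom.commutes, Algebra.algebraMap_eq_smul_one, ← coe_detOne hD]
      rfl)
    rw [h1, h2, map_smul, map_smul, hε, detCoOne_detOne hD]

end LinearAlgebra

/-! ### Rational functions with prescribed poles -/

theorem degLE_mono {a b : ℤ} (h : a ≤ b) : degLE a ≤ degLE b := fun _ hf =>
  hf.imp id fun hf => hf.trans h

theorem mul_mem_degLE {a b : ℤ} {f g : K} (hf : f ∈ degLE a) (hg : g ∈ degLE b) :
    f * g ∈ degLE (a + b) := by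
  by_cases hf0 : f = 0
  · rw [hf0, zero_mul]; exact zero_mem _
  by_cases hg0 : g = 0
  · rw [hg0, mul_zero]; exact zero_mem _
  refine Or.inr ?_
  rw [RatFunc.intDegree_mul hf0 hg0]
  exact add_le_add (hf.resolve_left hf0) (hg.resolve_left hg0)

theorem C_mem_degLE (c : ℂ) : (RatFunc.C c : K) ∈ degLE 0 := Or.inr (by simp)

theorem X_pow_mem_degLE (n : ℕ) : (RatFunc.X ^ n : K) ∈ degLE n := by
  have h := (mul_X_zpow_mem_degLE n (RatFunc.X ^ n)).mp
  refine h ?_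
  rw [zpow_neg, zpow_natCast, inv_mul_cancel₀ (pow_ne_zero _ RatFunc.X_ne_zero)]
  exact Or.inr (by simp)

theorem X_pow_mul_mem_degLE_iff (d e : ℤ) (f : K) :
    RatFunc.X ^ (-d) * f ∈ degLE e ↔ f ∈ degLE (d + e) := by
  rw [← mul_X_zpow_mem_degLE, ← mul_X_zpow_mem_degLE (d + e), ← mul_assoc,
    ← zpow_add₀ RatFunc.X_ne_zero]
  congr! 3
  ring

theorem algebraMap_mem_regular (x : ℂ) (P : Polynomial ℂ) :
    algebraMap (Polynomial ℂ) K P ∈ regular x := by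
  rw [mem_regular, RatFunc.denom_algebraMap]; simp

theorem inv_mem_regular {x : ℂ} {f : K} (hf : value x f ≠ 0) : f⁻¹ ∈ regular x := by
  have h : f.num.eval x / f.denom.eval x ≠ 0 := hf
  have h1 : f⁻¹ = algebraMap _ K f.denom / algebraMap _ K f.num := by
    conv_lhs => rw [← RatFunc.num_div_denom f, inv_div]
  have h2 : (f⁻¹).denom ∣ f.num := by rw [h1]; exact RatFunc.denom_div_dvd _ _
  obtain ⟨c, hc⟩ := h2
  rw [mem_regular]
  intro h3
  apply (div_ne_zero_iff.mp h).1
  rw [hc, Polynomial.eval_mul, h3, zero_mul]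

theorem value_loc_of_ne (x y : ℂ) : value x (loc y) = x - y := by
  have h : loc y = RatFunc.X + RatFunc.C (-y) := by simp [loc, sub_eq_add_neg]
  rw [h, value_add (X_mem x) (C_mem x _), value_C]
  simp [value, sub_eq_add_neg]

theorem inv_loc_mem_regular {x y : ℂ} (h : x ≠ y) : (loc y)⁻¹ ∈ regular x :=
  inv_mem_regular (by rw [value_loc_of_ne]; exact sub_ne_zero.mpr h)

theorem inv_loc_mem_degLE (y : ℂ) : (loc y)⁻¹ ∈ degLE (-1) := by
  have hl : loc y = algebraMap (Polynomial ℂ) K (Polynomial.X - Polynomial.C y) := by simp [loc]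
  refine Or.inr ?_
  rw [RatFunc.intDegree_inv, hl, RatFunc.intDegree_polynomial, Polynomial.natDegree_X_sub_C]
  simp

theorem exists_eq_algebraMap {f : K} (hf : ∀ x, f ∈ regular x) :
    ∃ P : Polynomial ℂ, f = algebraMap _ K P := by
  have h : f.denom.degree = 0 := by
    by_contra h
    obtain ⟨x, hx⟩ := IsAlgClosed.exists_root f.denom h
    exact hf x hx
  have h1 : f.denom = 1 := (RatFunc.monic_denom f).eq_one_of_isUnit
    (Polynomial.isUnit_iff_degree_eq_zero.mpr h)
  refine ⟨f.num, ?_⟩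
  conv_lhs => rw [← RatFunc.num_div_denom f, h1, map_one, div_one]

theorem algebraMap_mem_degLE_iff {P : Polynomial ℂ} {n : ℕ} :
    algebraMap _ K P ∈ degLE ((n : ℤ) - 1) ↔ P ∈ Polynomial.degreeLT ℂ n := by
  rw [Polynomial.mem_degreeLT]
  by_cases hP : P = 0
  · simp [hP]
  · have h0 : algebraMap _ K P ≠ 0 := by simpa using hP
    change _ ∨ _ ↔ _
    rw [RatFunc.intDegree_polynomial, Polynomial.degree_eq_natDegree hP]
    simp only [h0, false_or, Nat.cast_lt]
    omega

/-- A rational function without poles on `ℂ` that vanishes at infinity is zero. -/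
theorem eq_zero_of_regular {f : K} (hf : ∀ x, f ∈ regular x) (h : f ∈ degLE (-1)) : f = 0 := by
  obtain ⟨P, rfl⟩ := exists_eq_algebraMap hf
  have h1 := (algebraMap_mem_degLE_iff (n := 0)).mp (by simpa using h)
  rw [Polynomial.mem_degreeLT, Polynomial.degree_lt_iff_coeff_zero] at h1
  have : P = 0 := Polynomial.ext fun k => by simpa using h1 k (Nat.zero_le k)
  rw [this, map_zero]

/-- The local ring of `𝒪(-1)` at a point. -/
abbrev stalkNeg (x : OnePoint ℂ) : Submodule ℂ K :=
  x.elim (degLE (-1)) fun z => Subalgebra.toSubmodule (regular z)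

/-- Poles have finite order. -/
theorem exists_loc_pow_mul_mem (x : ℂ) (f : K) : ∃ n : ℕ, loc x ^ n * f ∈ regular x := by
  obtain ⟨D, hD, hnd⟩ := Polynomial.exists_eq_pow_rootMultiplicity_mul_and_not_dvd f.denom
    (RatFunc.denom_ne_zero f) x
  refine ⟨Polynomial.rootMultiplicity x f.denom, ?_⟩
  set n := Polynomial.rootMultiplicity x f.denom
  have hl : loc x = algebraMap (Polynomial ℂ) K (Polynomial.X - Polynomial.C x) := by simp [loc]
  have h : loc x ^ n * f = algebraMap _ K f.num / algebraMap _ K D := by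
    conv_lhs => rw [← RatFunc.num_div_denom f, hD, map_mul, map_pow, ← hl]
    rw [← mul_div_assoc, mul_div_mul_left _ _ (pow_ne_zero n (loc_ne_zero x))]
  have h2 : (loc x ^ n * f).denom ∣ D := by rw [h]; exact RatFunc.denom_div_dvd _ _
  obtain ⟨c, hc⟩ := h2
  rw [mem_regular]
  intro h3
  apply hnd
  rw [Polynomial.dvd_iff_isRoot, Polynomial.IsRoot, hc, Polynomial.eval_mul, h3, zero_mul]

/-- The polar part of a rational function at a point of `ℂ`, which is regular elsewhere on `ℂ` and
vanishes at infinity. -/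
theorem exists_polar_part (x : ℂ) (f : K) :
    ∃ P : K, f - P ∈ regular x ∧ (∀ y ≠ x, P ∈ regular y) ∧ P ∈ degLE (-1) := by
  obtain ⟨n, hn⟩ := exists_loc_pow_mul_mem x f
  induction n generalizing f with
  | zero => exact ⟨0, by simpa using hn, fun y _ => zero_mem _, zero_mem _⟩
  | succ n ih =>
    -- Subtracting the leading term of the polar part lowers the order of the pole.
    set c := value x (loc x ^ (n + 1) * f)
    set Q : K := c • (loc x)⁻¹ ^ (n + 1)
    have hl := loc_ne_zero x
    have e : loc x * (loc x ^ n * (f - Q)) = loc x ^ (n + 1) * f - RatFunc.C c := by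
      have h : loc x ^ (n + 1) * (loc x)⁻¹ ^ (n + 1) = 1 := by
        rw [← mul_pow, mul_inv_cancel₀ hl, one_pow]
      simp only [Q, smul_eq_C_mul]
      linear_combination -RatFunc.C c * h
    obtain ⟨P, h1, h2, h3⟩ := ih (f - Q) (mem_of_loc_mul
      (by rw [e]; exact sub_mem hn (C_mem _ _))
      (by rw [e, sub_eq_add_neg, ← map_neg, value_add hn (C_mem _ _), value_C, add_neg_cancel]))
    refine ⟨P + Q, by rwa [add_comm, ← sub_sub], fun y hy => add_mem (h2 y hy)
      (Subalgebra.smul_mem _ (pow_mem (inv_loc_mem_regular hy) _) _), add_mem h3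
      (Submodule.smul_mem _ _ ?_)⟩
    clear_value c
    clear * -
    induction n with
    | zero => simpa using inv_loc_mem_degLE x
    | succ n ih => 
      rw [pow_succ]; exact degLE_mono (by norm_num) (mul_mem_degLE ih (inv_loc_mem_degLE x))

/-- The polynomial part of a rational function. -/
theorem exists_polynomial_part (f : K) :
    ∃ P : Polynomial ℂ, f - algebraMap _ K P ∈ degLE (-1) := by
  refine ⟨f.num /ₘ f.denom, ?_⟩
  have hm := RatFunc.monic_denom f
  have h0 : algebraMap (Polynomial ℂ) K f.denom ≠ 0 := by simpa using RatFunc.denom_ne_zero f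
  have h : f - algebraMap _ K (f.num /ₘ f.denom) =
      algebraMap _ K (f.num %ₘ f.denom) / algebraMap _ K f.denom := by
    have h1 : f * algebraMap _ K f.denom = algebraMap _ K f.num :=
      ((div_eq_iff h0).mp (RatFunc.num_div_denom f)).symm
    rw [eq_div_iff h0, sub_mul, h1, Polynomial.modByMonic_eq_sub_mul_div, map_sub, map_mul,
      mul_comm (algebraMap (Polynomial ℂ) K f.denom)]
  rw [h]
  by_cases hr : f.num %ₘ f.denom = 0
  · rw [hr, map_zero, zero_div]; exact zero_mem _
  refine Or.inr ?_
  have hr' : algebraMap (Polynomial ℂ) K (f.num %ₘ f.denom) ≠ 0 := by simpa using hr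
  rw [div_eq_mul_inv, RatFunc.intDegree_mul hr' (inv_ne_zero h0), RatFunc.intDegree_inv,
    RatFunc.intDegree_polynomial, RatFunc.intDegree_polynomial]
  have := Polynomial.natDegree_lt_natDegree hr (Polynomial.degree_modByMonic_lt f.num hm)
  omega

/-- The Mittag-Leffler problem for `𝒪(-1)` with a single pole. -/
theorem exists_sub_mem_stalkNeg (a : OnePoint ℂ) (f : K) :
    ∃ P : K, f - P ∈ stalkNeg a ∧ ∀ x ≠ a, P ∈ stalkNeg x := by
  induction a with
  | infty =>
    obtain ⟨P, hP⟩ := exists_polynomial_part f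
    refine ⟨_, hP, fun x hx => ?_⟩
    induction x with
    | infty => exact absurd rfl hx
    | coe x => exact algebraMap_mem_regular x P
  | coe a =>
    obtain ⟨P, h1, h2, h3⟩ := exists_polar_part a f
    refine ⟨P, h1, fun x hx => ?_⟩
    induction x with
    | infty => exact h3
    | coe x => exact h2 x (by simpa using hx)

/-- The Mittag-Leffler problem for `𝒪(-1)` is solvable: `H¹(ℙ¹, 𝒪(-1)) = 0`. -/
theorem exists_mittagLeffler (S : Finset (OnePoint ℂ)) (t : OnePoint ℂ → K) :
    ∃ m : K, (∀ x ∈ S, t x - m ∈ stalkNeg x) ∧ ∀ x ∉ S, m ∈ stalkNeg x := by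
  classical
  induction S using Finset.induction_on with
  | empty => exact ⟨0, by simp, fun x _ => zero_mem _⟩
  | insert a S ha ih =>
    obtain ⟨m, h1, h2⟩ := ih
    obtain ⟨P, h3, h4⟩ := exists_sub_mem_stalkNeg a (t a - m)
    refine ⟨m + P, fun x hx => ?_, fun x hx => ?_⟩
    · rw [← sub_sub]
      rcases Finset.mem_insert.mp hx with rfl | hx
      · exact h3
      · exact sub_mem (h1 x hx) (h4 x fun h => ha (h ▸ hx))
    · rw [Finset.mem_insert, not_or] at hx
      exact add_mem (h2 x hx.2) (h4 x hx.1)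

/-! ### Simple partial fractions and their moments -/

/-- The rational function `∑_{y ∈ Y} r(y) / (z - y)`. -/
def pfrac (Y : Finset ℂ) (r : ℂ → ℂ) : K := ∑ y ∈ Y, r y • (loc y)⁻¹

theorem pfrac_mem_regular {Y : Finset ℂ} {r : ℂ → ℂ} {x : ℂ} (hx : x ∉ Y) :
    pfrac Y r ∈ regular x :=
  sum_mem fun _ hy =>
    Subalgebra.smul_mem _ (inv_loc_mem_regular (ne_of_mem_of_not_mem hy hx).symm) _

theorem pfrac_mem_degLE (Y : Finset ℂ) (r : ℂ → ℂ) : pfrac Y r ∈ degLE (-1) :=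
  sum_mem fun y _ => Submodule.smul_mem _ _ (inv_loc_mem_degLE y)

theorem loc_mul_pfrac {Y : Finset ℂ} {r : ℂ → ℂ} {x : ℂ} (hx : x ∈ Y) :
    loc x * pfrac Y r = RatFunc.C (r x) + loc x * pfrac (Y.erase x) r := by
  rw [pfrac, ← Finset.add_sum_erase Y _ hx, mul_add, ← pfrac, smul_eq_C_mul, mul_left_comm,
    mul_inv_cancel₀ (loc_ne_zero x), mul_one]

theorem loc_mul_pfrac_mem {Y : Finset ℂ} {r : ℂ → ℂ} {x : ℂ} (hx : x ∈ Y) :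
    loc x * pfrac Y r ∈ regular x := by
  rw [loc_mul_pfrac hx]
  exact add_mem (C_mem _ _) (mul_mem (loc_mem _ _) (pfrac_mem_regular (Finset.notMem_erase _ _)))

theorem value_loc_mul_pfrac {Y : Finset ℂ} {r : ℂ → ℂ} {x : ℂ} (hx : x ∈ Y) :
    value x (loc x * pfrac Y r) = r x := by
  have h := pfrac_mem_regular (r := r) (Finset.notMem_erase x Y)
  rw [loc_mul_pfrac hx, value_add (C_mem _ _) (mul_mem (loc_mem _ _) h), value_C,
    value_mul (loc_mem _ _) h, value_loc, zero_mul, add_zero]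

/-- The polynomial part of `z^m ∑ r(y) / (z - y)`: its coefficients are the moments of `r`. -/
def momentPoly (Y : Finset ℂ) (r : ℂ → ℂ) (m : ℕ) : Polynomial ℂ :=
  ∑ k ∈ Finset.range m, Polynomial.C (∑ y ∈ Y, r y * y ^ k) * Polynomial.X ^ (m - 1 - k)

theorem coeff_momentPoly (Y : Finset ℂ) (r : ℂ → ℂ) {m k : ℕ} (hk : k < m) :
    (momentPoly Y r m).coeff (m - 1 - k) = ∑ y ∈ Y, r y * y ^ k := by
  rw [momentPoly, Polynomial.finsetSum_coeff, Finset.sum_eq_single k]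
  · rw [Polynomial.coeff_C_mul_X_pow, if_pos rfl]
  · intro j hj hjk
    have := Finset.mem_range.mp hj
    rw [Polynomial.coeff_C_mul_X_pow, if_neg (by omega)]
  · intro h; exact absurd (Finset.mem_range.mpr hk) h

theorem X_pow_mul_pfrac_sub (Y : Finset ℂ) (r : ℂ → ℂ) (m : ℕ) :
    RatFunc.X ^ m * pfrac Y r - algebraMap _ K (momentPoly Y r m) ∈ degLE (-1) := by
  have h1 : ∀ y : ℂ, (RatFunc.X : K) ^ m * (loc y)⁻¹ =
      ∑ k ∈ Finset.range m, RatFunc.C y ^ k * RatFunc.X ^ (m - 1 - k) +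
        RatFunc.C (y ^ m) * (loc y)⁻¹ := by
    intro y
    have h := geom_sum₂_mul (RatFunc.C y : K) RatFunc.X m
    have hl := loc_ne_zero y
    rw [mul_inv_eq_iff_eq_mul₀ hl, add_mul, mul_assoc, inv_mul_cancel₀ hl, map_pow, loc]
    linear_combination h
  have h2 : RatFunc.X ^ m * pfrac Y r - algebraMap _ K (momentPoly Y r m) =
      pfrac Y fun y => r y * y ^ m := by
    simp only [pfrac, momentPoly, map_sum, Finset.mul_sum, smul_eq_C_mul, map_mul, map_pow,
      RatFunc.algebraMap_C, RatFunc.algebraMap_X, Finset.sum_mul]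
    rw [Finset.sum_comm, ← Finset.sum_sub_distrib]
    refine Finset.sum_congr rfl fun y _ => ?_
    rw [mul_left_comm, h1]
    simp only [mul_add, Finset.mul_sum, map_pow, mul_assoc]
    ring
  rw [h2]
  exact pfrac_mem_degLE _ _

/-- The residue theorem for `f z^k dz`, where `f` has at most simple poles, contained in `X`, and
`f = O(z^{-m-1})` at infinity. -/
theorem sum_residue_mul_pow_eq_zero {X : Finset ℂ} {f : K} {m : ℕ}
    (h1 : ∀ x ∉ X, f ∈ regular x) (h2 : ∀ x ∈ X, loc x * f ∈ regular x)
    (h3 : f ∈ degLE (-(m : ℤ) - 1)) {k : ℕ} (hk : k < m) :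
    ∑ x ∈ X, value x (loc x * f) * x ^ k = 0 := by
  set r : ℂ → ℂ := fun x => value x (loc x * f)
  -- `f` is determined by its residues, and its expansion at infinity by their moments.
  have hf : f = pfrac X r := by
    rw [← sub_eq_zero]
    refine eq_zero_of_regular (fun x => ?_)
      (sub_mem (degLE_mono (by omega) h3) (pfrac_mem_degLE _ _))
    by_cases hx : x ∈ X
    · have hm := loc_mul_pfrac_mem (r := r) hx
      refine mem_of_loc_mul (by rw [mul_sub]; exact sub_mem (h2 x hx) hm) ?_
      rw [mul_sub, sub_eq_add_neg, ← neg_one_smul ℂ (loc x * pfrac X r),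
        value_add (h2 x hx) (Subalgebra.smul_mem _ hm _), value_smul _ hm, value_loc_mul_pfrac hx]
      simp [r]
    · exact sub_mem (h1 x hx) (pfrac_mem_regular hx)
  have h4 : RatFunc.X ^ m * f ∈ degLE (-1) := by
    have := mul_mem_degLE (X_pow_mem_degLE m) h3
    rwa [show (m : ℤ) + (-(m : ℤ) - 1) = -1 by ring] at this
  have h5 : algebraMap _ K (momentPoly X r m) = 0 := by
    refine eq_zero_of_regular (fun x => algebraMap_mem_regular x _) ?_
    have := sub_mem h4 (hf ▸ X_pow_mul_pfrac_sub X r m)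
    rwa [sub_sub_cancel] at this
  have h6 : momentPoly X r m = 0 := by simpa using h5
  rw [← coeff_momentPoly X r hk, h6, Polynomial.coeff_zero]

/-! ### The Gram matrix -/

namespace Ensemble

variable {p q : ℕ} (E : Ensemble p q)

/-- The Gram matrix of `φ` and `ψ` with respect to the counting measure of a finite set. -/
def gramOn (Y : Finset ℂ) : Matrix (Fin E.N) (Fin E.N) ℂ :=
  Matrix.of fun i j => ∑ x ∈ Y, E.φ i x * E.ψ j x

/-- Andréief's identity: expanding both determinants, every pair of permutations contributes a
product of sums over single points. -/
theorem Z_eq_factorial_mul_det : E.Z = (E.N.factorial : ℂ) * E.gram.det := by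
  have h1 : ∀ σ τ : Equiv.Perm (Fin E.N),
      ∑ x : Fin E.N → E.X, ∏ i, (E.φ (σ i) (x i) * E.ψ (τ i) (x i)) =
        ∏ i, E.gram (σ i) (τ i) := by
    intro σ τ
    simp only [gram, Matrix.of_apply]
    have h (i : Fin E.N) := Finset.sum_coe_sort E.X fun x => E.φ (σ i) x * E.ψ (τ i) x
    simp only [← h, Finset.prod_univ_sum, Fintype.piFinset_univ]
  have h2 : ∀ σ : Equiv.Perm (Fin E.N), ∑ τ : Equiv.Perm (Fin E.N),
      ((σ.sign : ℤ) : ℂ) * (((τ.sign : ℤ) : ℂ) * ∏ i, E.gram (σ i) (τ i)) = E.gram.det := by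
    intro σ
    have h3 := Matrix.det_permute σ E.gram
    rw [← Matrix.det_transpose, Matrix.det_apply'] at h3
    rw [← Finset.mul_sum]
    simp only [Matrix.transpose_apply, Matrix.submatrix_apply, id] at h3
    rw [h3, ← mul_assoc, ← Int.cast_mul, ← Units.val_mul, Int.units_mul_self]
    simp
  have h4 : E.Z = ∑ σ : Equiv.Perm (Fin E.N), ∑ τ : Equiv.Perm (Fin E.N),
      ((σ.sign : ℤ) : ℂ) * (((τ.sign : ℤ) : ℂ) *
        ∑ x : Fin E.N → E.X, ∏ i, (E.φ (σ i) (x i) * E.ψ (τ i) (x i))) := by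
    simp only [Z, F, Matrix.det_apply', Matrix.of_apply, Finset.sum_mul_sum]
    rw [Finset.sum_comm]
    refine Finset.sum_congr rfl fun σ _ => ?_
    rw [Finset.sum_comm]
    refine Finset.sum_congr rfl fun τ _ => ?_
    simp only [Finset.mul_sum, Finset.prod_mul_distrib]
    refine Finset.sum_congr rfl fun x _ => ?_
    ring
  rw [h4]
  simp only [h1, h2]
  simp [Fintype.card_perm]

theorem det_gram_ne_zero (hZ : E.Z ≠ 0) : E.gram.det ≠ 0 := by
  rw [Z_eq_factorial_mul_det] at hZ
  exact (mul_ne_zero_iff.mp hZ).2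

theorem gramOn_add_gramOn_sdiff {Y : Finset ℂ} (hY : Y ⊆ E.X) :
    E.gramOn (E.X \ Y) + E.gramOn Y = E.gram := by
  ext i j
  exact Finset.sum_sdiff hY

/-- The Fredholm determinant compares the Gram matrices of `Y` and of the whole phase space. -/
theorem det_gramOn {Y : Finset ℂ} (hY : Y ⊆ E.X) (hG : E.gram.det ≠ 0) :
    (E.gramOn Y).det = E.gram.det * E.fredholm (E.X \ Y) := by
  -- `K = A G⁻ᵀ B`, and `det (1 - A (G⁻ᵀ B)) = det (1 - (G⁻ᵀ B) A)`.
  set T := E.X \ Y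
  let A : Matrix T (Fin E.N) ℂ := Matrix.of fun x i => E.φ i x
  let B : Matrix (Fin E.N) T ℂ := Matrix.of fun j y => E.ψ j y
  have hK : (Matrix.of fun x y : T => E.kernel x y) = A * ((E.gram⁻¹).transpose * B) := by
    ext x y
    simp only [kernel, Matrix.mul_apply, Matrix.of_apply, A, B, Finset.mul_sum]
    exact Finset.sum_congr rfl fun i _ => Finset.sum_congr rfl fun j _ => by ring
  have hT : (E.gramOn T).transpose = B * A := by
    ext i j
    simp only [gramOn, Matrix.transpose_apply, Matrix.mul_apply, Matrix.of_apply, A, B]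
    rw [← Finset.sum_coe_sort T]
    exact Finset.sum_congr rfl fun x _ => mul_comm _ _
  have hu : IsUnit E.gram.det := isUnit_iff_ne_zero.mpr hG
  have hY' : (E.gramOn Y).transpose =
      E.gram.transpose * (1 - (E.gram⁻¹).transpose * B * A) := by
    rw [mul_sub, mul_one, Matrix.mul_assoc, ← Matrix.mul_assoc E.gram.transpose,
      ← Matrix.transpose_mul,
      Matrix.nonsing_inv_mul _ hu, Matrix.transpose_one, Matrix.one_mul, ← hT,
      ← Matrix.transpose_sub, ← E.gramOn_add_gramOn_sdiff hY, add_sub_cancel_left]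
  rw [← Matrix.det_transpose, hY', Matrix.det_mul, Matrix.det_transpose,
    Matrix.det_one_sub_mul_comm, ← hK, fredholm]

/-- The enumeration of the functions `φ` by the pairs of a component and a degree. -/
def idx₁ : Fin E.N ≃ (i : Fin p) × Fin (E.n i) := finSigmaFinEquiv.symm

/-- The enumeration of the functions `ψ` by the pairs of a component and a degree. -/
def idx₂ : Fin E.N ≃ (j : Fin q) × Fin (E.m j) := (finCongr E.sum_eq).trans finSigmaFinEquiv.symm

/-- A linear combination of the `φ` is `∑ ω_{1,i} P_i` for polynomials `P_i` of degree less than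
`n_i`. -/
theorem sum_mul_φ (c : Fin E.N → ℂ) (x : ℂ) :
    ∑ k, c k * E.φ k x =
      ∑ i, E.ω₁ i x * ∑ l : Fin (E.n i), c (E.idx₁.symm ⟨i, l⟩) * x ^ (l : ℕ) := by
  rw [← E.idx₁.symm.sum_comp, Fintype.sum_sigma]
  refine Finset.sum_congr rfl fun i _ => ?_
  rw [Finset.mul_sum]
  refine Finset.sum_congr rfl fun l _ => ?_
  have h : E.φ (E.idx₁.symm ⟨i, l⟩) x =
      E.ω₁ (E.idx₁ (E.idx₁.symm ⟨i, l⟩)).1 x * x ^ ((E.idx₁ (E.idx₁.symm ⟨i, l⟩)).2 : ℕ) := rfl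
  rw [h, Equiv.apply_symm_apply]
  ring

theorem ψ_idx₂_symm (j : Fin q) (l : Fin (E.m j)) (x : ℂ) :
    E.ψ (E.idx₂.symm ⟨j, l⟩) x = E.ω₂ j x * x ^ (l : ℕ) := by
  have h : E.ψ (E.idx₂.symm ⟨j, l⟩) x =
      E.ω₂ (E.idx₂ (E.idx₂.symm ⟨j, l⟩)).1 x * x ^ ((E.idx₂ (E.idx₂.symm ⟨j, l⟩)).2 : ℕ) := rfl
  rw [h, Equiv.apply_symm_apply]

end Ensemble

/-! ### Global frames -/

section Frame

variable {ι : Type} [Fintype ι] [DecidableEq ι]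

/-- A matrix with entries in a subring and determinant `1` preserves and reflects the membership of
the coordinates of a vector in a module over that subring. -/
theorem mulVec_mem_iff {O : Subalgebra ℂ K} {N : Submodule ℂ K}
    (hN : ∀ f ∈ O, ∀ g ∈ N, f * g ∈ N) {M : Matrix ι ι K} (hM : ∀ i j, M i j ∈ O)
    (hdet : M.det = 1) (v : ι → K) : (∀ i, (M.mulVec v) i ∈ N) ↔ ∀ i, v i ∈ N := by
  have key : ∀ {A : Matrix ι ι K}, (∀ i j, A i j ∈ O) → ∀ {u : ι → K}, (∀ i, u i ∈ N) →
      ∀ i, (A.mulVec u) i ∈ N := fun hA _ hu i => sum_mem fun j _ => hN _ (hA i j) _ (hu j)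
  refine ⟨fun h => ?_, key hM⟩
  let M' : Matrix ι ι O := Matrix.of fun i j => ⟨M i j, hM i j⟩
  have hadj : M.adjugate = O.val.mapMatrix M'.adjugate := by
    rw [AlgHom.map_adjugate]; rfl
  have h1 := key (A := M.adjugate) (fun i j => by rw [hadj]; exact (M'.adjugate i j).2) h
  rwa [Matrix.mulVec_mulVec, Matrix.adjugate_mul, hdet, one_smul, Matrix.one_mulVec] at h1

theorem det_mem {O : Subalgebra ℂ K} {M : Matrix ι ι K} (hM : ∀ i j, M i j ∈ O) : M.det ∈ O := by
  rw [Matrix.det_apply']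
  exact sum_mem fun σ _ => mul_mem (intCast_mem _ _) (prod_mem fun i _ => hM _ _)

/-- The local ring of `ℙ¹` at infinity. -/
def regularInf : Subalgebra ℂ K where
  carrier := degLE 0
  mul_mem' := fun hf hg => by simpa using mul_mem_degLE hf hg
  add_mem' := fun hf hg => add_mem hf hg
  algebraMap_mem' := fun c => by rw [RatFunc.algebraMap_eq_C]; exact C_mem_degLE c

/-- The maximal ideal of the local ring at infinity. -/
def maxIdealInf : Ideal regularInf where
  carrier := {f | f.1 ∈ degLE (-1)}
  add_mem' := fun {f g} hf hg => (degLE (-1)).add_mem (x := f.1) (y := g.1) hf hg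
  zero_mem' := zero_mem (degLE (-1))
  smul_mem' := fun f g hg => by simpa using mul_mem_degLE (a := 0) (b := -1) f.2 hg

theorem mem_maxIdealInf {f : regularInf} : f ∈ maxIdealInf ↔ (f : K) ∈ degLE (-1) := Iff.rfl

omit [Fintype ι] in
theorem mem_regularInf_of_sub_one_mem {M : Matrix ι ι K}
    (hM : ∀ i j, M i j - (1 : Matrix ι ι K) i j ∈ degLE (-1)) (i j : ι) : M i j ∈ regularInf := by
  have h1 : (1 : Matrix ι ι K) i j ∈ regularInf := by
    rw [Matrix.one_apply]; split_ifs
    exacts [one_mem _, zero_mem _]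
  simpa using add_mem (S := Subalgebra ℂ K) (degLE_mono (by norm_num) (hM i j)) h1

/-- A matrix congruent to `1` modulo the maximal ideal at infinity has determinant congruent to
`1`. -/
theorem det_sub_one_mem_degLE {M : Matrix ι ι K}
    (hM : ∀ i j, M i j - (1 : Matrix ι ι K) i j ∈ degLE (-1)) : M.det - 1 ∈ degLE (-1) := by
  let M' : Matrix ι ι regularInf := Matrix.of fun i j =>
    ⟨M i j, mem_regularInf_of_sub_one_mem hM i j⟩
  have h1 : (Ideal.Quotient.mk maxIdealInf).mapMatrix M' = 1 := by
    rw [← map_one (Ideal.Quotient.mk maxIdealInf).mapMatrix]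
    ext i j
    refine Ideal.Quotient.eq.mpr ?_
    rw [mem_maxIdealInf, Subalgebra.coe_sub]
    have h2 : ((1 : Matrix ι ι regularInf) i j : K) = (1 : Matrix ι ι K) i j := by
      rw [Matrix.one_apply, Matrix.one_apply]; split_ifs <;> rfl
    rw [h2]; exact hM i j
  have h2 : Ideal.Quotient.mk maxIdealInf M'.det = Ideal.Quotient.mk maxIdealInf 1 := by
    rw [RingHom.map_det, h1, Matrix.det_one, map_one]
  have h3 : ((M'.det - 1 : regularInf) : K) ∈ degLE (-1) :=
    mem_maxIdealInf.mp (Ideal.Quotient.eq.mp h2)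
  have h4 : regularInf.val M'.det = M.det := by rw [AlgHom.map_det]; rfl
  rw [← h4]
  exact h3

end Frame

namespace Ensemble

variable {p q : ℕ} (E : Ensemble p q)

/-- The orders of the poles at infinity allowed in the components of sections of `L_∅(1)`. -/
def deg : Fin p ⊕ Fin q → ℤ := Sum.elim (fun i => (E.n i : ℤ)) fun j => -(E.m j : ℤ)

theorem sum_deg : ∑ k, E.deg k = 0 := by
  have := E.sum_eq
  simp only [deg, Fintype.sum_sum_type, Sum.elim_inl, Sum.elim_inr, Finset.sum_neg_distrib]
  rw [← Nat.cast_sum, ← Nat.cast_sum, this, add_neg_cancel]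

/-- The inverse of a local frame of `L_Y` at `y ∈ Y`; it is unipotent. -/
def unip (y : ℂ) : Matrix (Fin p ⊕ Fin q) (Fin p ⊕ Fin q) K :=
  Matrix.fromBlocks 1 0
    (Matrix.of fun j i => RatFunc.C (E.ω₂ j y) * RatFunc.C (E.ω₁ i y) * (loc y)⁻¹) 1

theorem det_unip (y : ℂ) : (E.unip y).det = 1 := by
  rw [unip, Matrix.det_fromBlocks_zero₁₂, Matrix.det_one, Matrix.det_one, one_mul]

theorem unip_mulVec_inl (y : ℂ) (s : Fin p ⊕ Fin q → K) (i : Fin p) :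
    (E.unip y).mulVec s (.inl i) = s (.inl i) := by
  simp [unip, Matrix.mulVec, dotProduct, Fintype.sum_sum_type, Matrix.one_apply]

theorem loc_mul_unip_mulVec_inr (y : ℂ) (s : Fin p ⊕ Fin q → K) (j : Fin q) :
    loc y * (E.unip y).mulVec s (.inr j) =
      RatFunc.C (E.ω₂ j y) * ∑ i, RatFunc.C (E.ω₁ i y) * s (.inl i) + loc y * s (.inr j) := by
  have hl := mul_inv_cancel₀ (loc_ne_zero y)
  simp only [unip, Matrix.mulVec, dotProduct, Fintype.sum_sum_type, Matrix.fromBlocks_apply₂₁,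
    Matrix.fromBlocks_apply₂₂, Matrix.of_apply, Matrix.one_apply, ite_mul, one_mul, zero_mul,
    Finset.sum_ite_eq, Finset.mem_univ, if_true, mul_add, Finset.mul_sum]
  congr 1
  refine Finset.sum_congr rfl fun i _ => ?_
  linear_combination RatFunc.C (E.ω₂ j y) * RatFunc.C (E.ω₁ i y) * s (.inl i) * hl

/-- `unip y` is the inverse of a frame: it maps the sections near `y` onto the regular vectors. -/
theorem mem_modStalk_iff (y : ℂ) (s : Fin p ⊕ Fin q → K) :
    s ∈ E.modStalk y ↔ ∀ k, (E.unip y).mulVec s k ∈ regular y := by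
  set a : Fin q → K := fun j => RatFunc.C (E.ω₂ j y) * ∑ i, RatFunc.C (E.ω₁ i y) * s (.inl i)
  have hreg : (∀ i, s (.inl i) ∈ regular y) → ∀ j, a j ∈ regular y := fun h j =>
    mul_mem (C_mem _ _) (sum_mem fun i _ => mul_mem (C_mem _ _) (h i))
  have hval : (∀ i, s (.inl i) ∈ regular y) → ∀ j, value y (a j) =
      E.ω₂ j y * ∑ i, E.ω₁ i y * value y (s (.inl i)) := by
    intro h j
    rw [value_mul (C_mem _ _) (sum_mem fun i _ => mul_mem (C_mem _ _) (h i)), value_C,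
      value_sum _ _ fun i _ => mul_mem (C_mem _ _) (h i)]
    congr 1
    exact Finset.sum_congr rfl fun i _ => by rw [value_mul (C_mem _ _) (h i), value_C]
  constructor
  · rintro ⟨h1, h2, h3⟩ (i | j)
    · rw [unip_mulVec_inl]; exact h1 i
    · refine mem_of_loc_mul ?_ ?_
      · rw [loc_mul_unip_mulVec_inr]; exact add_mem (hreg h1 j) (h2 j)
      · rw [loc_mul_unip_mulVec_inr, value_add (hreg h1 j) (h2 j), hval h1, h3, add_neg_cancel]
  · intro h
    have h1 : ∀ i, s (.inl i) ∈ regular y := fun i => by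
      rw [← E.unip_mulVec_inl y s i]; exact h (.inl i)
    have e : ∀ j, loc y * s (.inr j) =
        loc y * (E.unip y).mulVec s (.inr j) + (-1 : ℂ) • a j := fun j => by
      rw [loc_mul_unip_mulVec_inr, neg_one_smul]; ring
    have h4 : ∀ j, loc y * (E.unip y).mulVec s (.inr j) ∈ regular y := fun j =>
      mul_mem (loc_mem y y) (h (.inr j))
    have h5 : ∀ j, (-1 : ℂ) • a j ∈ regular y := fun j => Subalgebra.smul_mem _ (hreg h1 j) _
    refine ⟨h1, fun j => ?_, fun j => ?_⟩
    · rw [e]; exact add_mem (h4 j) (h5 j)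
    · rw [e, value_add (h4 j) (h5 j), value_loc_mul (h (.inr j)), value_smul _ (hreg h1 j),
        hval h1]
      ring

/-- If the Gram matrix on `Y` is invertible, then `L_Y(1)` has a global section with any given
leading coefficients at infinity. -/
theorem exists_section {Y : Finset ℂ} (hY : (E.gramOn Y).det ≠ 0) (a : Fin p ⊕ Fin q → ℂ) :
    ∃ s : Fin p ⊕ Fin q → K, (∀ y : ℂ, s ∈ (E.L Y).stalk y) ∧
      ∀ k, RatFunc.X ^ (-E.deg k) * s k - RatFunc.C (a k) ∈ degLE (-1) := by
  set F₀ : ℂ → ℂ := fun y => ∑ i, a (.inl i) * E.ω₁ i y * y ^ E.n i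
  -- The coefficients of the polynomials `s_{1,i}` below their leading terms have to make the
  -- moments of the residues of the `s_{2,j}` vanish, except for the last ones.
  obtain ⟨c, hc⟩ : ∃ c : Fin E.N → ℂ, ∀ l, ∑ k, c k * E.gramOn Y k l =
      -(∑ y ∈ Y, F₀ y * E.ψ l y) -
        if ((E.idx₂ l).2 : ℕ) = E.m (E.idx₂ l).1 - 1 then a (.inr (E.idx₂ l).1) else 0 := by
    refine ⟨Matrix.vecMul (fun l => -(∑ y ∈ Y, F₀ y * E.ψ l y) -
        if ((E.idx₂ l).2 : ℕ) = E.m (E.idx₂ l).1 - 1 then a (.inr (E.idx₂ l).1) else 0)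
        (E.gramOn Y)⁻¹, fun l => ?_⟩
    change Matrix.vecMul _ (E.gramOn Y) l = _
    rw [Matrix.vecMul_vecMul, Matrix.nonsing_inv_mul _ (isUnit_iff_ne_zero.mpr hY),
      Matrix.vecMul_one]
  set P : Fin p → Polynomial ℂ := fun i => ∑ l : Fin (E.n i),
    Polynomial.C (c (E.idx₁.symm ⟨i, l⟩)) * Polynomial.X ^ (l : ℕ)
  have hP : ∀ i, P i ∈ Polynomial.degreeLT ℂ (E.n i) := fun i => sum_mem fun l _ => by
    rw [Polynomial.mem_degreeLT]
    exact (Polynomial.degree_C_mul_X_pow_le _ _).trans_lt (by exact_mod_cast l.2)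
  set Q : Fin p → Polynomial ℂ := fun i =>
    Polynomial.C (a (.inl i)) * Polynomial.X ^ E.n i + P i
  set F : ℂ → ℂ := fun y => ∑ i, E.ω₁ i y * (Q i).eval y with hFdef
  have hF : ∀ y, F y = F₀ y + ∑ k, c k * E.φ k y := by
    intro y
    rw [sum_mul_φ, ← Finset.sum_add_distrib]
    refine Finset.sum_congr rfl fun i _ => ?_
    simp only [Q, P, Polynomial.eval_add, Polynomial.eval_mul, Polynomial.eval_C,
      Polynomial.eval_pow, Polynomial.eval_X, Polynomial.eval_finsetSum]
    ring
  set r : Fin q → ℂ → ℂ := fun j y => -(E.ω₂ j y * F y)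
  have hr : ∀ j, ∀ k < E.m j, ∑ y ∈ Y, r j y * y ^ k =
      if k = E.m j - 1 then a (.inr j) else 0 := by
    intro j k hk
    have h := hc (E.idx₂.symm ⟨j, ⟨k, hk⟩⟩)
    rw [Equiv.apply_symm_apply] at h
    simp only [gramOn, Matrix.of_apply, Finset.mul_sum, ψ_idx₂_symm] at h
    rw [Finset.sum_comm] at h
    have h2 : ∑ y ∈ Y, r j y * y ^ k = -(∑ y ∈ Y, F₀ y * (E.ω₂ j y * y ^ k)) -
        ∑ y ∈ Y, ∑ i, c i * (E.φ i y * (E.ω₂ j y * y ^ k)) := by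
      rw [← Finset.sum_neg_distrib, ← Finset.sum_sub_distrib]
      refine Finset.sum_congr rfl fun y _ => ?_
      simp only [r, hF, ← mul_assoc, ← Finset.sum_mul]
      ring
    rw [h2, h]; ring
  have hmom : ∀ j, momentPoly Y (r j) (E.m j) +
      Polynomial.X ^ E.m j * Polynomial.C (if E.m j = 0 then a (.inr j) else 0) =
        Polynomial.C (a (.inr j)) := by
    intro j
    by_cases hj : E.m j = 0
    · simp [hj, momentPoly]
    · rw [if_neg hj, map_zero, mul_zero, add_zero, momentPoly,
        Finset.sum_congr rfl fun k hk => by rw [hr j k (Finset.mem_range.mp hk)],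
        Finset.sum_eq_single (E.m j - 1)]
      · simp
      · intro k _ hk; simp [hk]
      · intro h; exact absurd (Finset.mem_range.mpr (by omega)) h
  -- For `m_j = 0` there is no moment that could supply the leading coefficient of `s_{2,j}`, but
  -- then a constant term is allowed.
  refine ⟨Sum.elim (fun i => algebraMap _ K (Q i)) fun j =>
    pfrac Y (r j) + RatFunc.C (if E.m j = 0 then a (.inr j) else 0), fun y => ?_, ?_⟩
  · by_cases hy : y ∈ Y
    · rw [E.L_stalk_of_mem hy]
      refine ⟨fun i => algebraMap_mem_regular _ _, fun j => ?_, fun j => ?_⟩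
      · rw [Sum.elim_inr, mul_add]
        exact add_mem (loc_mul_pfrac_mem hy) (mul_mem (loc_mem _ _) (C_mem _ _))
      · rw [Sum.elim_inr, mul_add, value_add (loc_mul_pfrac_mem hy)
          (mul_mem (loc_mem _ _) (C_mem _ _)), value_loc_mul_pfrac hy, value_loc_mul (C_mem _ _),
          add_zero]
        simp [r, F, value, RatFunc.eval_algebraMap]
    · rw [E.L_stalk_of_notMem hy, mem_L₀_stalk]
      rintro (i | j)
      · exact algebraMap_mem_regular _ _
      · exact add_mem (pfrac_mem_regular hy) (C_mem _ _)
  · rintro (i | j)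
    · have h : RatFunc.X ^ (-(E.n i : ℤ)) * algebraMap _ K (Q i) - RatFunc.C (a (.inl i)) =
          RatFunc.X ^ (-(E.n i : ℤ)) * algebraMap _ K (P i) := by
        have hX := inv_mul_cancel₀ (pow_ne_zero (E.n i) (RatFunc.X_ne_zero (K := ℂ)))
        simp only [Q, map_add, map_mul, map_pow, RatFunc.algebraMap_C, RatFunc.algebraMap_X,
          zpow_neg, zpow_natCast]
        linear_combination RatFunc.C (a (.inl i)) * hX
      simp only [deg, Sum.elim_inl]
      rw [h, X_pow_mul_mem_degLE_iff]
      exact algebraMap_mem_degLE_iff.mpr (hP i)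
    · have h := X_pow_mul_pfrac_sub Y (r j) (E.m j)
      simp only [deg, Sum.elim_inr, neg_neg, zpow_natCast]
      convert h using 1
      have h2 := congrArg (algebraMap _ K) (hmom j)
      simp only [map_add, map_mul, map_pow, RatFunc.algebraMap_C, RatFunc.algebraMap_X] at h2
      linear_combination h2

/-- If the Gram matrix on `Y` is invertible, then `L_Y ≃ 𝒪(-1)^(p+q)`: a global frame of `L_Y(1)`
is given by the sections whose leading coefficients at infinity are the coordinate vectors. -/
theorem L_iso {Y : Finset ℂ} (hY : (E.gramOn Y).det ≠ 0) :
    (E.L Y).Iso (split fun _ => -1) := by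
  choose s hs hs' using fun k : Fin p ⊕ Fin q => E.exists_section hY (Pi.single k 1)
  let P : Matrix (Fin p ⊕ Fin q) (Fin p ⊕ Fin q) K := Matrix.of fun i k => s k i
  -- `D` trivializes `L_Y(1)` at infinity; its determinant is `1` because `∑ n_i = ∑ m_j`.
  let D : Matrix (Fin p ⊕ Fin q) (Fin p ⊕ Fin q) K :=
    Matrix.diagonal fun k => RatFunc.X ^ (-E.deg k)
  have hD : D.det = 1 := by
    have h : ∀ (t : Finset (Fin p ⊕ Fin q)), ∏ k ∈ t, (RatFunc.X : K) ^ (-E.deg k) =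
        RatFunc.X ^ (-∑ k ∈ t, E.deg k) := by
      intro t
      induction t using Finset.induction_on with
      | empty => simp
      | insert a t ha ih =>
        rw [Finset.prod_insert ha, Finset.sum_insert ha, ih, neg_add,
          zpow_add₀ RatFunc.X_ne_zero]
    rw [Matrix.det_diagonal, h, E.sum_deg, neg_zero, zpow_zero]
  have hDP : ∀ i k, (D * P) i k = RatFunc.X ^ (-E.deg i) * s k i := fun i k => by
    simp [D, P, Matrix.diagonal_mul]
  have hDP1 : ∀ i k, (D * P) i k - (1 : Matrix _ _ K) i k ∈ degLE (-1) := fun i k => by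
    rw [hDP]
    convert hs' k i using 2
    rw [Matrix.one_apply, Pi.single_apply]
    split_ifs <;> simp
  have hUP : ∀ y ∈ Y, ∀ i k, (E.unip y * P) i k ∈ regular y := fun y hy i k =>
    (E.mem_modStalk_iff y (s k)).mp (by rw [← E.L_stalk_of_mem hy]; exact hs k y) i
  have hPr : ∀ y ∉ Y, ∀ i k, P i k ∈ regular y := fun y hy i k =>
    E.mem_L₀_stalk.mp (by rw [← E.L_stalk_of_notMem hy]; exact hs k y) i
  have hdet : P.det = 1 := by
    rw [← sub_eq_zero]
    refine eq_zero_of_regular (fun y => sub_mem ?_ (one_mem _)) ?_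
    · by_cases hy : y ∈ Y
      · have := det_mem (hUP y hy)
        rwa [Matrix.det_mul, det_unip, one_mul] at this
      · exact det_mem (hPr y hy)
    · have := det_sub_one_mem_degLE hDP1
      rwa [Matrix.det_mul, hD, one_mul] at this
  have hu : IsUnit P.det := by rw [hdet]; exact isUnit_one
  refine ⟨Matrix.toLin'OfInv (Matrix.mul_nonsing_inv P hu) (Matrix.nonsing_inv_mul P hu),
    fun x t => ?_⟩
  set v := Matrix.toLin'OfInv (Matrix.mul_nonsing_inv P hu) (Matrix.nonsing_inv_mul P hu) t with hv
  have ht : t = P.mulVec v := by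
    rw [hv]
    simp [Matrix.toLin'OfInv, Matrix.mulVec_mulVec, Matrix.mul_nonsing_inv P hu]
  induction x with
  | infty =>
    have h1 : t ∈ (E.L Y).stalk OnePoint.infty ↔ ∀ i, ((D * P).mulVec v) i ∈ degLE (-1) := by
      rw [← Matrix.mulVec_mulVec, ← ht]
      simp only [D, Matrix.mulVec_diagonal, X_pow_mul_mem_degLE_iff]
      change t ∈ Submodule.pi Set.univ _ ↔ _
      simp only [Submodule.mem_pi, Set.mem_univ, true_imp_iff]
      refine forall_congr' fun k => ?_
      rcases k with i | j <;> simp [deg, sub_eq_add_neg]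
    rw [h1, mulVec_mem_iff (O := regularInf)
      (fun f hf g hg => by simpa using mul_mem_degLE (a := 0) (b := -1) hf hg)
      (fun i j => ?_) (by rw [Matrix.det_mul, hD, hdet, one_mul])]
    · simp [split, Submodule.mem_pi]
    · exact mem_regularInf_of_sub_one_mem hDP1 i j
  | coe x =>
    have h2 : v ∈ (split fun _ : Fin p ⊕ Fin q => -1).stalk x ↔ ∀ i, v i ∈ regular x := by
      simp [split, Submodule.mem_pi]
    rw [h2]
    by_cases hx : x ∈ Y
    · rw [E.L_stalk_of_mem hx, mem_modStalk_iff, ht, Matrix.mulVec_mulVec]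
      exact mulVec_mem_iff (N := Subalgebra.toSubmodule (regular x))
        (fun f hf g hg => (regular x).mul_mem hf hg) (hUP x hx)
        (by rw [Matrix.det_mul, det_unip, hdet, one_mul]) v
    · rw [E.L_stalk_of_notMem hx, mem_L₀_stalk, ht]
      exact mulVec_mem_iff (N := Subalgebra.toSubmodule (regular x))
        (fun f hf g hg => (regular x).mul_mem hf hg) (hPr x hx) hdet v

end Ensemble

/-! ### Cohomology of modifications -/

section Cohomology

variable {ι : Type} {L L' : Bundle ι} {S : Finset (OnePoint ℂ)}

theorem mem_split_neg_one {x : OnePoint ℂ} {s : ι → K} :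
    s ∈ (split fun _ => -1).stalk x ↔ ∀ i, s i ∈ stalkNeg x := by
  induction x with
  | infty => simp [split, Submodule.mem_pi]
  | coe x => simp [split, Submodule.mem_pi]

theorem Bundle.mem_H0 {s : ι → K} : s ∈ L.H0 ↔ ∀ x, s ∈ L.stalk x := Submodule.mem_iInf _

theorem Bundle.mem_mero {s : ι → K} : s ∈ L.mero S ↔ ∀ x ∉ S, s ∈ L.stalk x := by
  simp [Bundle.mero, Submodule.mem_iInf]

theorem Bundle.Iso.H0_eq_bot (h : L.Iso (split fun _ => -1)) : L.H0 = ⊥ := by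
  obtain ⟨g, hg⟩ := h
  rw [eq_bot_iff]
  intro s hs
  rw [Submodule.mem_bot, ← g.map_eq_zero_iff]
  funext i
  have h1 : ∀ x, g s i ∈ stalkNeg x := fun x =>
    mem_split_neg_one.mp ((hg x s).mp (Bundle.mem_H0.mp hs x)) i
  exact eq_zero_of_regular (fun x => h1 x) (h1 OnePoint.infty)

/-- The Mittag-Leffler problem is solvable for bundles isomorphic to a sum of copies of `𝒪(-1)`. -/
theorem Bundle.Iso.exists_mittagLeffler (h : L.Iso (split fun _ => -1)) (S : Finset (OnePoint ℂ))
    (t : OnePoint ℂ → ι → K) : ∃ m ∈ L.mero S, ∀ x ∈ S, t x - m ∈ L.stalk x := by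
  obtain ⟨g, hg⟩ := h
  choose m h1 h2 using fun i => GapTau.exists_mittagLeffler S fun x => g (t x) i
  refine ⟨g.symm m, Bundle.mem_mero.mpr fun x hx => ?_, fun x hx => ?_⟩
  · rw [hg, g.apply_symm_apply, mem_split_neg_one]
    exact fun i => h2 i x hx
  · rw [hg, map_sub, g.apply_symm_apply, mem_split_neg_one]
    exact fun i => h1 i x hx

theorem Bundle.Iso.subsingleton_H0 (h : L.Iso (split fun _ => -1)) : Subsingleton L.H0 := by
  rw [h.H0_eq_bot]; infer_instance

theorem Bundle.Iso.subsingleton_H1 (h : L.Iso (split fun _ => -1)) (S : Finset (OnePoint ℂ)) :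
    Subsingleton (L.H1 S) := by
  classical
  rw [Submodule.Quotient.subsingleton_iff, LinearMap.range_eq_top]
  intro ξ
  choose t ht using fun x : S => Submodule.mkQ_surjective _ (ξ x)
  obtain ⟨m, hm, hm'⟩ := h.exists_mittagLeffler S fun x => if hx : x ∈ S then t ⟨x, hx⟩ else 0
  refine ⟨⟨m, hm⟩, funext fun x => ?_⟩
  have h1 := hm' x x.2
  rw [dif_pos x.2] at h1
  rw [← ht x]
  exact ((Submodule.Quotient.eq _).mpr h1).symm

theorem Bundle.inclH0_injective (h : ∀ x, L.stalk x ≤ L'.stalk x) :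
    Function.Injective (L.inclH0 L' h) :=
  Submodule.inclusion_injective _

theorem Bundle.toQuot_apply_eq_zero_iff {s : L'.H0} :
    L.toQuot L' S s = 0 ↔ ∀ x ∈ S, (s : ι → K) ∈ L.stalk x := by
  constructor
  · intro h x hx
    exact (Submodule.Quotient.mk_eq_zero ((L.stalk x).submoduleOf (L'.stalk x))).mp
      (congrFun h (⟨x, hx⟩ : S))
  · intro h
    exact funext fun x => (Submodule.Quotient.mk_eq_zero _).mpr (h x x.2)

theorem Bundle.exact_inclH0_toQuot (h : ∀ x, L.stalk x ≤ L'.stalk x)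
    (hS : ∀ x ∉ S, L'.stalk x = L.stalk x) :
    Function.Exact (L.inclH0 L' h) (L.toQuot L' S) := by
  intro s
  rw [Bundle.toQuot_apply_eq_zero_iff]
  constructor
  · intro hs
    refine ⟨⟨s, Bundle.mem_H0.mpr fun x => ?_⟩, rfl⟩
    by_cases hx : x ∈ S
    · exact hs x hx
    · rw [← hS x hx]; exact Bundle.mem_H0.mp s.2 x
  · rintro ⟨t, rfl⟩ x -
    exact Bundle.mem_H0.mp t.2 x

theorem Bundle.exact_toQuot_connecting (h : ∀ x, L.stalk x ≤ L'.stalk x)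
    (hS : ∀ x ∉ S, L'.stalk x = L.stalk x) :
    Function.Exact (L.toQuot L' S) (L.connecting L' S) := by
  intro ξ
  choose r hr using fun x : S => Submodule.mkQ_surjective _ (ξ x)
  have hconn : L.connecting L' S ξ = (LinearMap.range (L.toPolar S)).mkQ
      fun x => (L.stalk x).mkQ (r x : ι → K) := by
    refine congrArg (LinearMap.range (L.toPolar S)).mkQ (funext fun x => ?_)
    change Submodule.mapQ _ _ _ le_rfl (ξ x) = _
    rw [← hr x]; rfl
  rw [hconn, Submodule.mkQ_apply, Submodule.Quotient.mk_eq_zero]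
  constructor
  · rintro ⟨m, hm⟩
    have h1 : ∀ x : S, (m : ι → K) - r x ∈ L.stalk x := fun x =>
      (Submodule.Quotient.eq _).mp (congrFun hm x)
    have h2 : (m : ι → K) ∈ L'.H0 := by
      refine Bundle.mem_H0.mpr fun x => ?_
      by_cases hx : x ∈ S
      · have := add_mem (h x (h1 ⟨x, hx⟩)) (r ⟨x, hx⟩).2
        rwa [sub_add_cancel] at this
      · exact h x (Bundle.mem_mero.mp m.2 x hx)
    refine ⟨⟨m, h2⟩, funext fun x => ?_⟩
    rw [← hr x]
    exact (Submodule.Quotient.eq _).mpr (h1 x)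
  · rintro ⟨s, rfl⟩
    refine ⟨⟨s, Bundle.mem_mero.mpr fun x hx => ?_⟩, funext fun x => ?_⟩
    · rw [← hS x hx]; exact Bundle.mem_H0.mp s.2 x
    · refine (Submodule.Quotient.eq _).mpr ?_
      have := (Submodule.Quotient.eq _).mp (hr x)
      rw [← neg_mem_iff, neg_sub]
      exact this

/-- The connecting map is surjective, because `H¹(L') = 0`. -/
theorem Bundle.connecting_surjective (hS : ∀ x ∉ S, L'.stalk x = L.stalk x)
    (hL' : ∀ t : OnePoint ℂ → ι → K, ∃ m ∈ L'.mero S, ∀ x ∈ S, t x - m ∈ L'.stalk x) :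
    Function.Surjective (L.connecting L' S) := by
  classical
  intro ξ
  obtain ⟨ξ, rfl⟩ := Submodule.mkQ_surjective _ ξ
  choose t ht using fun x : S => Submodule.mkQ_surjective _ (ξ x)
  obtain ⟨m, hm, hm'⟩ := hL' fun x => if hx : x ∈ S then t ⟨x, hx⟩ else 0
  have h1 : ∀ x : S, t x - m ∈ L'.stalk x := fun x => by
    have := hm' x x.2
    rwa [dif_pos x.2] at this
  refine ⟨fun x => Submodule.mkQ _ ⟨t x - m, h1 x⟩, ?_⟩
  have hm₀ : m ∈ L.mero S := Bundle.mem_mero.mpr fun x hx => by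
    rw [← hS x hx]; exact Bundle.mem_mero.mp hm x hx
  refine (Submodule.Quotient.eq _).mpr ⟨-⟨m, hm₀⟩, funext fun x => ?_⟩
  change (L.stalk x).mkQ (-m) = (L.stalk x).mkQ (t x - m) - ξ x
  rw [← ht x, ← map_sub]
  congr 1
  abel

end Cohomology

namespace Ensemble

/-! ### The upper modification -/

variable {p q : ℕ} (E : Ensemble p q) {Y : Finset ℂ} {S : Finset (OnePoint ℂ)}

theorem Lup_stalk_eq_LX [NeZero q] {x : OnePoint ℂ} (hY : Y ⊆ E.X)
    (hx : ∀ y ∈ E.X \ Y, x ≠ (y : OnePoint ℂ)) : (E.Lup Y).stalk x = (E.L E.X).stalk x := by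
  induction x with
  | infty => rfl
  | coe x =>
    have hxT : x ∉ E.X \ Y := fun h => hx x h rfl
    rw [E.Lup_stalk_of_notMem hxT]
    by_cases hxY : x ∈ Y
    · rw [E.L_stalk_of_mem hxY, E.L_stalk_of_mem (hY hxY)]
    · have hxX : x ∉ E.X := fun h => hxT (Finset.mem_sdiff.mpr ⟨h, hxY⟩)
      rw [E.L_stalk_of_notMem hxY, E.L_stalk_of_notMem hxX]

theorem Lup_stalk_eq_LY [NeZero q] {x : OnePoint ℂ} (hx : ∀ y ∈ E.X \ Y, x ≠ (y : OnePoint ℂ)) :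
    (E.Lup Y).stalk x = (E.L Y).stalk x := by
  induction x with
  | infty => rfl
  | coe x => exact E.Lup_stalk_of_notMem fun h => hx x h rfl

/-- The section `c w_x / (z - x)` of the upper modification at `x`. -/
def polarSection (x c : ℂ) : Fin p ⊕ Fin q → K :=
  Sum.elim (fun _ => 0) fun j => RatFunc.C (c * E.ω₂ j x) * (loc x)⁻¹

theorem loc_mul_polarSection_inr (x c : ℂ) (j : Fin q) :
    loc x * E.polarSection x c (.inr j) = RatFunc.C (c * E.ω₂ j x) := by
  rw [polarSection, Sum.elim_inr, mul_left_comm, mul_inv_cancel₀ (loc_ne_zero x), mul_one]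

theorem polarSection_mem (x c : ℂ) : E.polarSection x c ∈ E.upStalk x := by
  refine ⟨fun i => zero_mem _, fun j => ?_, c, fun j => ?_⟩
  · rw [loc_mul_polarSection_inr]; exact C_mem _ _
  · rw [loc_mul_polarSection_inr, value_C]; rfl

theorem fAt_polarSection [NeZero q] {x : ℂ} (hx : x ∈ E.X \ Y) (c : ℂ)
    (h : E.polarSection x c ∈ (E.Lup Y).stalk x) : E.fAt x hx ⟨E.polarSection x c, h⟩ = c := by
  have hw : E.ω₂ 0 x ≠ 0 := E.ω₂_ne_zero 0 x (Finset.mem_sdiff.mp hx).1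
  change value x (E.pairing x (E.polarSection x c)) = c
  rw [E.value_pairing (E.polarSection_mem x c), loc_mul_polarSection_inr, value_C]
  simp only [polarSection, Sum.elim_inl, value_zero, mul_zero, Finset.sum_const_zero, zero_add]
  field_simp

theorem gAt_polarSection [NeZero q] {x : ℂ} (hx : x ∈ E.X \ Y) (c : ℂ)
    (h : E.polarSection x c ∈ (E.Lup Y).stalk x) : E.gAt x hx ⟨E.polarSection x c, h⟩ = c := by
  have hw : E.ω₂ 0 x ≠ 0 := E.ω₂_ne_zero 0 x (Finset.mem_sdiff.mp hx).1
  change value x (loc x * E.polarSection x c (.inr 0)) / E.ω₂ 0 x = c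
  rw [loc_mul_polarSection_inr, value_C, mul_div_cancel_right₀ _ hw]

open Classical in
/-- Polar sections with prescribed coefficients at the points of `X - Y`. -/
def polarFamily (u : ↥(E.X \ Y) → ℂ) (x : OnePoint ℂ) : Fin p ⊕ Fin q → K :=
  x.elim 0 fun x => if h : x ∈ E.X \ Y then E.polarSection x (u ⟨x, h⟩) else 0

theorem polarFamily_coe (u : ↥(E.X \ Y) → ℂ) (x : ↥(E.X \ Y)) :
    E.polarFamily u (x : ℂ) = E.polarSection x (u x) := dif_pos x.2

theorem polarFamily_mem [NeZero q] (u : ↥(E.X \ Y) → ℂ) (x : OnePoint ℂ) :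
    E.polarFamily u x ∈ (E.Lup Y).stalk x := by
  induction x with
  | infty => exact zero_mem _
  | coe x =>
    by_cases hx : x ∈ E.X \ Y
    · rw [E.polarFamily_coe u ⟨x, hx⟩, E.Lup_stalk_of_mem hx]; exact E.polarSection_mem _ _
    · have : E.polarFamily u x = 0 := dif_neg hx
      rw [this]; exact zero_mem _

theorem fMap_apply [NeZero q] (hS : ∀ x ∈ E.X, (x : OnePoint ℂ) ∈ S)
    (r : ∀ x : S, (E.Lup Y).stalk x) (x : ↥(E.X \ Y)) :
    E.fMap Y S hS (fun x => Submodule.mkQ _ (r x)) x =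
      E.fAt x.1 x.2 (r ⟨(x : ℂ), hS x (Finset.mem_sdiff.mp x.2).1⟩) := rfl

theorem gMap_apply [NeZero q] (hS : ∀ x ∈ E.X, (x : OnePoint ℂ) ∈ S)
    (r : ∀ x : S, (E.Lup Y).stalk x) (x : ↥(E.X \ Y)) :
    E.gMap Y S hS (fun x => Submodule.mkQ _ (r x)) x =
      E.gAt x.1 x.2 (r ⟨(x : ℂ), hS x (Finset.mem_sdiff.mp x.2).1⟩) := rfl

/-- The kernel of `f_x` on the sections of `L_Y^up` near `x` consists of the sections of `L_X`. -/
theorem mem_modStalk_of_value_pairing_eq_zero [NeZero q] {x : ℂ} (hx : x ∈ E.X)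
    {s : Fin p ⊕ Fin q → K} (hs : s ∈ E.upStalk x) (h : value x (E.pairing x s) = 0) :
    s ∈ E.modStalk x := by
  have hw : E.ω₂ 0 x ≠ 0 := E.ω₂_ne_zero 0 x hx
  rw [E.value_pairing hs] at h
  obtain ⟨h1, h2, c, hc⟩ := hs
  refine ⟨h1, h2, fun j => ?_⟩
  have hc0 := hc 0
  simp only [w, Sum.elim_inr] at hc hc0
  rw [hc0] at h
  have h3 : (E.ω₂ 0 x)⁻¹ * (c * E.ω₂ 0 x) = c := by field_simp
  rw [h3] at h
  rw [hc]
  linear_combination E.ω₂ j x * h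

theorem fMap_bijective [NeZero q] (hY : Y ⊆ E.X) (hS : ∀ x ∈ E.X, (x : OnePoint ℂ) ∈ S) :
    Function.Bijective (E.fMap Y S hS) := by
  constructor
  · rw [injective_iff_map_eq_zero]
    intro ξ hξ
    choose r hr using fun x : S => Submodule.mkQ_surjective _ (ξ x)
    obtain rfl : (fun x => Submodule.mkQ _ (r x)) = ξ := funext hr
    refine funext fun x => (Submodule.Quotient.mk_eq_zero _).mpr ?_
    change (r x : Fin p ⊕ Fin q → K) ∈ (E.L E.X).stalk x
    by_cases hx : ∃ y ∈ E.X \ Y, (x : OnePoint ℂ) = (y : OnePoint ℂ)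
    · obtain ⟨y, hy, hxy⟩ := hx
      obtain ⟨x, hxS⟩ := x
      subst hxy
      have h := congrFun hξ ⟨y, hy⟩
      rw [fMap_apply] at h
      have hyX := (Finset.mem_sdiff.mp hy).1
      rw [E.L_stalk_of_mem hyX]
      exact E.mem_modStalk_of_value_pairing_eq_zero hyX
        (by rw [← E.Lup_stalk_of_mem hy]; exact (r ⟨y, hxS⟩).2) h
    · push Not at hx
      rw [← E.Lup_stalk_eq_LX hY hx]; exact (r x).2
  · intro u
    refine ⟨fun x => Submodule.mkQ _ ⟨_, E.polarFamily_mem u x⟩, funext fun x => ?_⟩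
    rw [fMap_apply]
    simp only [polarFamily_coe]
    exact E.fAt_polarSection x.2 (u x) _

theorem gMap_bijective [NeZero q] (hS : ∀ x ∈ E.X, (x : OnePoint ℂ) ∈ S) :
    Function.Bijective (E.gMap Y S hS) := by
  constructor
  · rw [injective_iff_map_eq_zero]
    intro ξ hξ
    choose r hr using fun x : S => Submodule.mkQ_surjective _ (ξ x)
    obtain rfl : (fun x => Submodule.mkQ _ (r x)) = ξ := funext hr
    refine funext fun x => (Submodule.Quotient.mk_eq_zero _).mpr ?_
    change (r x : Fin p ⊕ Fin q → K) ∈ (E.L Y).stalk x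
    by_cases hx : ∃ y ∈ E.X \ Y, (x : OnePoint ℂ) = (y : OnePoint ℂ)
    · obtain ⟨y, hy, hxy⟩ := hx
      obtain ⟨x, hxS⟩ := x
      subst hxy
      have h := congrFun hξ ⟨y, hy⟩
      rw [gMap_apply] at h
      have hw : E.ω₂ 0 y ≠ 0 := E.ω₂_ne_zero 0 y (Finset.mem_sdiff.mp hy).1
      have hs : (r ⟨y, hxS⟩ : Fin p ⊕ Fin q → K) ∈ E.upStalk y := by
        rw [← E.Lup_stalk_of_mem hy]; exact (r ⟨y, hxS⟩).2
      have h0 : value y (loc y * (r ⟨y, hxS⟩ : Fin p ⊕ Fin q → K) (.inr 0)) = 0 :=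
        (div_eq_zero_iff.mp h).resolve_right hw
      rw [E.L_stalk_of_notMem (Finset.mem_sdiff.mp hy).2, mem_L₀_stalk]
      obtain ⟨h1, h2, c, hc⟩ := hs
      have hc0 : c = 0 := by
        rw [hc 0] at h0
        exact (mul_eq_zero.mp h0).resolve_right hw
      rintro (i | j)
      · exact h1 i
      · exact mem_of_loc_mul (h2 j) (by rw [hc, hc0, zero_mul])
    · push Not at hx
      rw [← E.Lup_stalk_eq_LY hx]; exact (r x).2
  · intro u
    refine ⟨fun x => Submodule.mkQ _ ⟨_, E.polarFamily_mem u x⟩, funext fun x => ?_⟩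
    rw [gMap_apply]
    simp only [polarFamily_coe]
    exact E.gAt_polarSection x.2 (u x) _

/-- The residue theorem for a global section of `L_Y^up`: its coordinates `f` and `g` at the points
of `X - Y` are related by the operator `1 - K`. -/
theorem gMap_toQuot_eq [NeZero q] (hY : Y ⊆ E.X) (hG : E.gram.det ≠ 0)
    (hS : ∀ x ∈ E.X, (x : OnePoint ℂ) ∈ S) (s : (E.Lup Y).H0) :
    E.gMap Y S hS ((E.L Y).toQuot (E.Lup Y) S s) =
      (1 - Matrix.of fun x y : ↥(E.X \ Y) => E.kernel x y).mulVec
        (E.fMap Y S hS ((E.L E.X).toQuot (E.Lup Y) S s)) := by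
  obtain ⟨s, hs⟩ := s
  have hs' := Bundle.mem_H0.mp hs
  have hreg : ∀ i x, s (.inl i) ∈ regular x := by
    intro i x
    have h := hs' x
    by_cases hx : x ∈ E.X \ Y
    · rw [E.Lup_stalk_of_mem hx] at h; exact h.1 i
    · rw [E.Lup_stalk_of_notMem hx] at h
      by_cases hxY : x ∈ Y
      · rw [E.L_stalk_of_mem hxY] at h; exact h.1 i
      · rw [E.L_stalk_of_notMem hxY, mem_L₀_stalk] at h; exact h _
  have hinf : ∀ k, s k ∈ degLE
      (Sum.elim (fun i => (E.n i : ℤ) - 1) (fun j => -(E.m j : ℤ) - 1) k) := fun k =>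
    (Submodule.mem_pi.mp (hs' OnePoint.infty)) k trivial
  choose P hP using fun i => exists_eq_algebraMap (hreg i)
  have hPdeg : ∀ i, P i ∈ Polynomial.degreeLT ℂ (E.n i) := fun i =>
    algebraMap_mem_degLE_iff.mp (by rw [← hP]; exact hinf (.inl i))
  set F : ℂ → ℂ := fun x => ∑ i, E.ω₁ i x * value x (s (.inl i)) with hF
  set c : Fin E.N → ℂ := fun k => (P (E.idx₁ k).1).coeff (E.idx₁ k).2
  have hFφ : ∀ x, F x = ∑ k, c k * E.φ k x := by
    intro x
    rw [sum_mul_φ]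
    refine Finset.sum_congr rfl fun i _ => ?_
    congr 1
    have h1 : value x (s (.inl i)) = (P i).eval x := by
      rw [hP]; simp [value, RatFunc.eval_algebraMap]
    have h2 : ∀ l : Fin (E.n i), c (E.idx₁.symm ⟨i, l⟩) = (P i).coeff l := fun l => by
      simp only [c]; rw [Equiv.apply_symm_apply]
    rw [h1, Polynomial.eval_eq_sum_degreeLTEquiv (hPdeg i)]
    simp only [h2]
    rfl
  -- At every point of `X` the polar part of `s` is a multiple of `w_x`.
  set R : ℂ → ℂ := fun x => value x (loc x * s (.inr 0)) / E.ω₂ 0 x with hR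
  have hres : ∀ x ∈ E.X, (∀ j, loc x * s (.inr j) ∈ regular x) ∧
      ∀ j, value x (loc x * s (.inr j)) = R x * E.ω₂ j x := by
    intro x hx
    have hw : E.ω₂ 0 x ≠ 0 := E.ω₂_ne_zero 0 x hx
    have h : s ∈ E.upStalk x := by
      by_cases hxT : x ∈ E.X \ Y
      · rw [← E.Lup_stalk_of_mem hxT]; exact hs' x
      · have hxY : x ∈ Y := by by_contra h; exact hxT (Finset.mem_sdiff.mpr ⟨hx, h⟩)
        refine E.modStalk_le x ?_
        rw [← E.L_stalk_of_mem hxY, ← E.Lup_stalk_of_notMem hxT]; exact hs' x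
    obtain ⟨-, h2, d, hd⟩ := h
    have hd0 : R x = d := by
      simp only [hR, hd 0, w, Sum.elim_inr]; rw [mul_div_cancel_right₀ _ hw]
    exact ⟨h2, fun j => by rw [hd, hd0]; rfl⟩
  have hRY : ∀ x ∈ Y, F x + R x = 0 := by
    intro x hx
    have hw : E.ω₂ 0 x ≠ 0 := E.ω₂_ne_zero 0 x (hY hx)
    have h := hs' x
    rw [E.Lup_stalk_of_notMem fun h => (Finset.mem_sdiff.mp h).2 hx, E.L_stalk_of_mem hx] at h
    simp only [hR, h.2.2 0]
    field_simp
    simp [hF]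
  have hRψ : ∀ l, ∑ x ∈ E.X, R x * E.ψ l x = 0 := by
    intro l
    obtain ⟨⟨j, k⟩, rfl⟩ := E.idx₂.symm.surjective l
    rw [← sum_residue_mul_pow_eq_zero (X := E.X) (f := s (.inr j)) (m := E.m j) (k := k)
      (fun x hx => ?_) (fun x hx => (hres x hx).1 j) (hinf (.inr j)) k.2]
    · refine Finset.sum_congr rfl fun x hx => ?_
      rw [(hres x hx).2, ψ_idx₂_symm]; ring
    · have h := hs' x
      rw [E.Lup_stalk_of_notMem fun h => hx (Finset.mem_sdiff.mp h).1,
        E.L_stalk_of_notMem fun h => hx (hY h), mem_L₀_stalk] at h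
      exact h _
  have hf : ∀ x : ↥(E.X \ Y), E.fMap Y S hS ((E.L E.X).toQuot (E.Lup Y) S ⟨s, hs⟩) x =
      F x + R x := by
    intro x
    change value x.1 (E.pairing x.1 s) = _
    rw [E.value_pairing (by rw [← E.Lup_stalk_of_mem x.2]; exact hs' x), hR, hF]
    ring
  have hg : ∀ x : ↥(E.X \ Y), E.gMap Y S hS ((E.L Y).toQuot (E.Lup Y) S ⟨s, hs⟩) x = R x :=
    fun x => rfl
  -- The coefficients of the polynomials `s_{1,i}` solve a linear system with the Gram matrix.
  have hc : ∀ l, Matrix.vecMul c E.gram l = ∑ y : ↥(E.X \ Y), (F y + R y) * E.ψ l y := by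
    intro l
    rw [Finset.sum_coe_sort (E.X \ Y) fun y => (F y + R y) * E.ψ l y]
    have h1 : ∑ y ∈ E.X, (F y + R y) * E.ψ l y = ∑ y ∈ E.X \ Y, (F y + R y) * E.ψ l y := by
      rw [← Finset.sum_sdiff hY, Finset.sum_eq_zero (s := Y) fun y hy => by rw [hRY y hy, zero_mul],
        add_zero]
    rw [← h1]
    simp only [add_mul, Finset.sum_add_distrib, hRψ, add_zero, hFφ]
    simp only [Matrix.vecMul, dotProduct, gram, Matrix.of_apply, Finset.mul_sum, Finset.sum_mul]
    rw [Finset.sum_comm]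
    exact Finset.sum_congr rfl fun x _ => Finset.sum_congr rfl fun k _ => by ring
  have hc' : ∀ k, c k = ∑ l, (∑ y : ↥(E.X \ Y), (F y + R y) * E.ψ l y) * E.gram⁻¹ l k := by
    intro k
    have : c = Matrix.vecMul (Matrix.vecMul c E.gram) E.gram⁻¹ := by
      rw [Matrix.vecMul_vecMul, Matrix.mul_nonsing_inv _ (isUnit_iff_ne_zero.mpr hG),
        Matrix.vecMul_one]
    conv_lhs => rw [this]
    simp only [← hc]; rfl
  have hFK : ∀ x, F x = ∑ y : ↥(E.X \ Y), E.kernel x y * (F y + R y) := by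
    intro x
    rw [hFφ]
    simp only [hc', kernel, Matrix.transpose_apply, Finset.sum_mul]
    rw [Finset.sum_comm (s := (Finset.univ : Finset ↥(E.X \ Y)))]
    refine Finset.sum_congr rfl fun k _ => ?_
    rw [Finset.sum_comm (s := (Finset.univ : Finset ↥(E.X \ Y)))]
    exact Finset.sum_congr rfl fun l _ => Finset.sum_congr rfl fun y _ => by ring
  funext x
  rw [hg, Matrix.sub_mulVec, Matrix.one_mulVec, Pi.sub_apply, hf]
  have h3 := hFK x
  simp only [Matrix.mulVec, dotProduct, Matrix.of_apply, hf]
  rw [← h3]; ring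

end Ensemble

open Module

/-! ### The `τ`-function -/

/-- Comparison of the trivializations of two lines `detRΓ`, for bundles without cohomology, with
the same line `det B ⊗ (det C)⁻¹`: they differ by the determinant of `q_X⁻¹ h⁻¹ q_Y`. -/
theorem inducedDetIso_detOne_eq_det_smul {A A' B C C' D D' : Type}
    [AddCommGroup A] [Module ℂ A] [AddCommGroup A'] [Module ℂ A'] [AddCommGroup B] [Module ℂ B]
    [AddCommGroup C] [Module ℂ C] [AddCommGroup C'] [Module ℂ C'] [AddCommGroup D] [Module ℂ D]
    [AddCommGroup D'] [Module ℂ D'] [FiniteDimensional ℂ B]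
    {i : A →ₗ[ℂ] B} {q : B →ₗ[ℂ] C} {δ : C →ₗ[ℂ] D}
    {i' : A' →ₗ[ℂ] B} {q' : B →ₗ[ℂ] C'} {δ' : C' →ₗ[ℂ] D'}
    {e : (DetLine A ⊗[ℂ] Dual ℂ (DetLine D)) ≃ₗ[ℂ] (DetLine B ⊗[ℂ] Dual ℂ (DetLine C))}
    {e' : (DetLine A' ⊗[ℂ] Dual ℂ (DetLine D')) ≃ₗ[ℂ] (DetLine B ⊗[ℂ] Dual ℂ (DetLine C'))}
    (he : IsInducedDetIso i q δ e) (he' : IsInducedDetIso i' q' δ' e')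
    (hA : finrank ℂ A = 0) (hD : finrank ℂ D = 0) (hA' : finrank ℂ A' = 0)
    (hD' : finrank ℂ D' = 0) (hq : Function.Injective q) (hBC : finrank ℂ B = finrank ℂ C)
    (h : C' ≃ₗ[ℂ] C) {u : B →ₗ[ℂ] B} (hu : q = h.toLinearMap ∘ₗ q' ∘ₗ u)
    {d : ℂ} (hd : LinearMap.det u = d) :
    e' (detOne A' ⊗ₜ[ℂ] detCoOne D') = d •
      TensorProduct.congr (LinearEquiv.refl ℂ _) (detCongr h).dualMap
        (e (detOne A ⊗ₜ[ℂ] detCoOne D)) := by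
  subst hd
  obtain ⟨β, hβ⟩ := exists_detLine_ne_zero (V := B)
  have lift : ∀ {E : Type} [AddCommGroup E] [Module ℂ E] (g : B →ₗ[ℂ] E),
      finrank ℂ B = finrank ℂ E →
      ∃ θ : DetLine E, (θ : ExteriorAlgebra ℂ E) = ExteriorAlgebra.map g β := fun g hg =>
    ⟨⟨_, hg ▸ map_mem_extPow g β.2⟩, rfl⟩
  obtain ⟨θ, hθ⟩ := lift q hBC
  obtain ⟨θ', hθ'⟩ := lift q' (hBC.trans h.finrank_eq.symm)
  have hθ0 : θ ≠ 0 := by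
    rintro rfl
    refine hβ (exteriorPower.map_injective_field (n := finrank ℂ B) hq ?_)
    rw [map_zero]
    exact Subtype.ext (by rw [coe_extPow_map, ← hθ]; rfl)
  obtain ⟨ε, hε⟩ := exists_dual_apply_eq_one hθ0
  have hcoe : ∀ x : DetLine C', (detCongr h x : ExteriorAlgebra ℂ C) =
      ExteriorAlgebra.map h.toLinearMap x := fun x => coe_extPow_map _ h.toLinearMap x
  have hθθ' : θ = LinearMap.det u • detCongr h θ' := by
    refine Subtype.ext ?_
    have h1 := congrArg (fun x : DetLine B => ExteriorAlgebra.map (h.toLinearMap ∘ₗ q') x)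
      (map_det_eq_smul u β)
    simp only [coe_extPow_map] at h1
    rw [Submodule.coe_smul, hcoe, hθ, hu, hθ', ← AlgHom.comp_apply (ExteriorAlgebra.map _),
      ExteriorAlgebra.map_comp_map, ← map_smul, ← Submodule.coe_smul, ← h1,
      ← AlgHom.comp_apply (ExteriorAlgebra.map _), ExteriorAlgebra.map_comp_map,
      LinearMap.comp_assoc]
  have hε' : (LinearMap.det u • (detCongr h).dualMap ε) θ' = 1 := by
    rw [LinearMap.smul_apply, LinearEquiv.dualMap_apply, ← map_smul, ← hθθ', hε]
  rw [he.apply_detOne hA hD hθ hε, he'.apply_detOne hA' hD' hθ' hε', TensorProduct.congr_tmul,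
    TensorProduct.tmul_smul]
  rfl

theorem dual_apply_eq_of_apply_eq_smul {V V' W W' : Type} [AddCommMonoid V] [Module ℂ V]
    [AddCommMonoid V'] [Module ℂ V'] [AddCommMonoid W] [Module ℂ W] [AddCommMonoid W']
    [Module ℂ W']
    (τ : Dual ℂ V) {e : V ≃ₗ[ℂ] W} {e' : V' ≃ₗ[ℂ] W'} {c : W' ≃ₗ[ℂ] W} {x : V} {x' : V'} {d : ℂ}
    (h : e x = d • c (e' x')) :
    τ x = (d • (τ ∘ₗ (e' ≪≫ₗ c ≪≫ₗ e.symm).toLinearMap)) x' := by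
  rw [e.eq_symm_apply.mpr h, map_smul, map_smul]
  rfl

theorem Bundle.Iso.tau_apply_detOne {ι : Type} {L : Bundle ι} (h : L.Iso (split fun _ => -1))
    (S : Finset (OnePoint ℂ)) : L.tau S (detOne L.H0 ⊗ₜ[ℂ] detCoOne (L.H1 S)) = 1 := by
  have := h.subsingleton_H0
  have := h.subsingleton_H1 S
  rw [Bundle.tau, if_pos h, TensorProduct.dualDistrib_apply, Module.Dual.eval_apply,
    detCoOne_detOne finrank_zero_of_subsingleton, detCoOne_detOne finrank_zero_of_subsingleton,
    one_mul]

/-- For a bundle without cohomology the canonical element generates `detRΓ`. -/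
theorem Bundle.Iso.dual_ext {ι : Type} {L : Bundle ι} (h : L.Iso (split fun _ => -1))
    {S : Finset (OnePoint ℂ)} {a b : Dual ℂ (L.DetRGamma S)}
    (hab : a (detOne L.H0 ⊗ₜ[ℂ] detCoOne (L.H1 S)) = b (detOne L.H0 ⊗ₜ[ℂ] detCoOne (L.H1 S))) :
    a = b := by
  have := h.subsingleton_H0
  have := h.subsingleton_H1 S
  have h1 : detOne L.H0 ⊗ₜ[ℂ] detCoOne (L.H1 S) ≠ 0 := fun h0 => by
    have := h.tau_apply_detOne S
    rw [h0, map_zero] at this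
    exact zero_ne_one this
  have hdim : finrank ℂ (L.DetRGamma S) = 1 := by
    rw [finrank_tensorProduct, finrank_detLine, finrank_dual_detLine]
  refine LinearMap.ext fun y => ?_
  obtain ⟨c, rfl⟩ := (finrank_eq_one_iff_of_nonzero' (V := L.DetRGamma S) _ h1).mp hdim y
  rw [map_smul, map_smul, hab]

namespace Ensemble

variable {p q : ℕ} (E : Ensemble p q) {Y : Finset ℂ} {S : Finset (OnePoint ℂ)}

theorem LX_iso (hZ : E.Z ≠ 0) : (E.L E.X).Iso (split fun _ => -1) :=
  E.L_iso (Y := E.X) (E.det_gram_ne_zero hZ)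

theorem fredholm_ne_zero_iff (hZ : E.Z ≠ 0) (hY : Y ⊆ E.X) :
    E.fredholm (E.X \ Y) ≠ 0 ↔ (E.gramOn Y).det ≠ 0 := by
  rw [E.det_gramOn hY (E.det_gram_ne_zero hZ)]
  simp [E.det_gram_ne_zero hZ]

variable [NeZero q]

/-- `H¹(L_Y^up) = 0`, because `L_X ⊆ L_Y^up` and `H¹(L_X) = 0`. -/
theorem exists_mittagLeffler_Lup (hZ : E.Z ≠ 0) (hY : Y ⊆ E.X) (S : Finset (OnePoint ℂ))
    (t : OnePoint ℂ → Fin p ⊕ Fin q → K) :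
    ∃ m ∈ (E.Lup Y).mero S, ∀ x ∈ S, t x - m ∈ (E.Lup Y).stalk x := by
  obtain ⟨m, hm, hm'⟩ := (E.LX_iso hZ).exists_mittagLeffler S t
  exact ⟨m, Bundle.mem_mero.mpr fun x hx => E.LX_le_Lup hY x (Bundle.mem_mero.mp hm x hx),
    fun x hx => E.LX_le_Lup hY x (hm' x hx)⟩

theorem Lup_stalk_eq_LX_of_notMem (hY : Y ⊆ E.X) (hS : ∀ x ∈ E.X, (x : OnePoint ℂ) ∈ S)
    (x : OnePoint ℂ) (hx : x ∉ S) : (E.Lup Y).stalk x = (E.L E.X).stalk x :=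
  E.Lup_stalk_eq_LX hY fun y hy h => hx (h ▸ hS y (Finset.mem_sdiff.mp hy).1)

theorem Lup_stalk_eq_LY_of_notMem (hS : ∀ x ∈ E.X, (x : OnePoint ℂ) ∈ S)
    (x : OnePoint ℂ) (hx : x ∉ S) : (E.Lup Y).stalk x = (E.L Y).stalk x :=
  E.Lup_stalk_eq_LY fun y hy h => hx (h ▸ hS y (Finset.mem_sdiff.mp hy).1)

/-- `L_X` has no cohomology, so the sections of `L_Y^up` are those of `L_Y^up / L_X`. -/
theorem toQuot_LX_bijective (hZ : E.Z ≠ 0) (hY : Y ⊆ E.X)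
    (hS : ∀ x ∈ E.X, (x : OnePoint ℂ) ∈ S) :
    Function.Bijective ((E.L E.X).toQuot (E.Lup Y) S) := by
  have hSX := E.Lup_stalk_eq_LX_of_notMem hY hS
  have := (E.LX_iso hZ).subsingleton_H0
  have := (E.LX_iso hZ).subsingleton_H1 S
  constructor
  · rw [injective_iff_map_eq_zero]
    intro s hs
    obtain ⟨t, rfl⟩ := (Bundle.exact_inclH0_toQuot (E.LX_le_Lup hY) hSX s).mp hs
    rw [Subsingleton.elim t 0, map_zero]
  · intro ξ
    exact (Bundle.exact_toQuot_connecting (E.LX_le_Lup hY) hSX ξ).mp (Subsingleton.elim _ _)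

/-- If `L_Y` has no global sections, then `1 - K` is injective on `ℓ²(X - Y)`: it is the map `g` in
the coordinates `f`, and the kernel of `g` on `H⁰(L_Y^up)` is `H⁰(L_Y)`. -/
theorem fredholm_ne_zero_of_iso (hZ : E.Z ≠ 0) (hY : Y ⊆ E.X)
    (h : (E.L Y).Iso (split fun _ => -1)) : E.fredholm (E.X \ Y) ≠ 0 := by
  classical
  set S : Finset (OnePoint ℂ) := E.X.image OnePoint.some
  have hS : ∀ x ∈ E.X, (x : OnePoint ℂ) ∈ S := fun x hx => Finset.mem_image_of_mem _ hx
  intro h0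
  obtain ⟨v, hv, hv'⟩ := Matrix.exists_mulVec_eq_zero_iff.mpr h0
  obtain ⟨ξ, rfl⟩ := (E.fMap_bijective hY hS).2 v
  obtain ⟨s, rfl⟩ := (E.toQuot_LX_bijective hZ hY hS).2 ξ
  have h1 := E.gMap_toQuot_eq hY (E.det_gram_ne_zero hZ) hS s
  rw [hv', LinearMap.map_eq_zero_iff _ (E.gMap_bijective hS).1,
    Bundle.exact_inclH0_toQuot (E.L_le_Lup Y) (E.Lup_stalk_eq_LY_of_notMem hS)] at h1
  obtain ⟨t, rfl⟩ := h1
  have := h.subsingleton_H0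
  rw [Subsingleton.elim t 0, map_zero, map_zero, map_zero] at hv
  exact hv rfl

/-- The isomorphism `f_{X-Y}` of `H⁰(L_Y^up / L_X)` with `ℂ^(X-Y)`. -/
def fEquiv (hY : Y ⊆ E.X) (hS : ∀ x ∈ E.X, (x : OnePoint ℂ) ∈ S) :
    (E.L E.X).Quot (E.Lup Y) S ≃ₗ[ℂ] (↥(E.X \ Y) → ℂ) :=
  LinearEquiv.ofBijective _ (E.fMap_bijective hY hS)

/-- The isomorphism `g_{X-Y}` of `H⁰(L_Y^up / L_Y)` with `ℂ^(X-Y)`. -/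
def gEquiv (Y : Finset ℂ) (hS : ∀ x ∈ E.X, (x : OnePoint ℂ) ∈ S) :
    (E.L Y).Quot (E.Lup Y) S ≃ₗ[ℂ] (↥(E.X \ Y) → ℂ) :=
  LinearEquiv.ofBijective _ (E.gMap_bijective hS)

/-- The isomorphism of `H⁰(L_Y^up)` with `H⁰(L_Y^up / L_X)`. -/
def quotEquiv (hZ : E.Z ≠ 0) (hY : Y ⊆ E.X) (hS : ∀ x ∈ E.X, (x : OnePoint ℂ) ∈ S) :
    (E.Lup Y).H0 ≃ₗ[ℂ] (E.L E.X).Quot (E.Lup Y) S :=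
  LinearEquiv.ofBijective _ (E.toQuot_LX_bijective hZ hY hS)

/-- The operator `1 - K` on `ℓ²(X - Y)`, transported to `H⁰(L_Y^up)` by the coordinates `f`. -/
def oneSubKernel (hZ : E.Z ≠ 0) (hY : Y ⊆ E.X) (hS : ∀ x ∈ E.X, (x : OnePoint ℂ) ∈ S) :
    (E.Lup Y).H0 →ₗ[ℂ] (E.Lup Y).H0 :=
  ((E.quotEquiv hZ hY hS ≪≫ₗ E.fEquiv hY hS).symm.toLinearMap ∘ₗ
    Matrix.toLin' (1 - Matrix.of fun x y : ↥(E.X \ Y) => E.kernel x y)) ∘ₗ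
      (E.quotEquiv hZ hY hS ≪≫ₗ E.fEquiv hY hS).toLinearMap

theorem det_oneSubKernel (hZ : E.Z ≠ 0) (hY : Y ⊆ E.X) (hS : ∀ x ∈ E.X, (x : OnePoint ℂ) ∈ S) :
    LinearMap.det (E.oneSubKernel hZ hY hS) = E.fredholm (E.X \ Y) := by
  have h := LinearMap.det_conj
    (Matrix.toLin' (1 - Matrix.of fun x y : ↥(E.X \ Y) => E.kernel x y))
    (E.quotEquiv hZ hY hS ≪≫ₗ E.fEquiv hY hS).symm
  rw [LinearMap.det_toLin', LinearEquiv.symm_symm] at h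
  exact h

/-- Up to the identification of the two quotients by `f` and `g`, the maps from `H⁰(L_Y^up)` to
them differ by `1 - K`. -/
theorem toQuot_LY_eq (hZ : E.Z ≠ 0) (hY : Y ⊆ E.X) (hS : ∀ x ∈ E.X, (x : OnePoint ℂ) ∈ S) :
    (E.L Y).toQuot (E.Lup Y) S = (E.fEquiv hY hS ≪≫ₗ (E.gEquiv Y hS).symm).toLinearMap ∘ₗ
      (E.L E.X).toQuot (E.Lup Y) S ∘ₗ E.oneSubKernel hZ hY hS := by
  refine LinearMap.ext fun s => ?_
  set A := E.quotEquiv hZ hY hS ≪≫ₗ E.fEquiv hY hS with hA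
  have hAf : ∀ t, E.fEquiv hY hS ((E.L E.X).toQuot (E.Lup Y) S t) = A t := fun t => rfl
  have h1 : E.gEquiv Y hS ((E.L Y).toQuot (E.Lup Y) S s) =
      (1 - Matrix.of fun x y : ↥(E.X \ Y) => E.kernel x y).mulVec (A s) :=
    E.gMap_toQuot_eq hY (E.det_gram_ne_zero hZ) hS s
  rw [← (E.gEquiv Y hS).injective.eq_iff, h1]
  simp only [oneSubKernel, LinearMap.comp_apply, LinearEquiv.coe_coe, LinearEquiv.trans_apply,
    LinearEquiv.apply_symm_apply, hAf, ← hA, Matrix.toLin'_apply]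

theorem toQuot_LY_injective_of_iso (hS : ∀ x ∈ E.X, (x : OnePoint ℂ) ∈ S)
    (h : (E.L Y).Iso (split fun _ => -1)) : Function.Injective ((E.L Y).toQuot (E.Lup Y) S) := by
  have := h.subsingleton_H0
  rw [injective_iff_map_eq_zero]
  intro s hs
  obtain ⟨t, rfl⟩ := (Bundle.exact_inclH0_toQuot (E.L_le_Lup Y)
    (E.Lup_stalk_eq_LY_of_notMem hS) s).mp hs
  rw [Subsingleton.elim t 0, map_zero]

theorem finite_quot_LX (hY : Y ⊆ E.X) (hS : ∀ x ∈ E.X, (x : OnePoint ℂ) ∈ S) :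
    FiniteDimensional ℂ ((E.L E.X).Quot (E.Lup Y) S) := Module.Finite.equiv (E.fEquiv hY hS).symm

theorem finite_quot_LY (Y : Finset ℂ) (hS : ∀ x ∈ E.X, (x : OnePoint ℂ) ∈ S) :
    FiniteDimensional ℂ ((E.L Y).Quot (E.Lup Y) S) := Module.Finite.equiv (E.gEquiv Y hS).symm

theorem finite_H0_Lup (hZ : E.Z ≠ 0) (hY : Y ⊆ E.X) (hS : ∀ x ∈ E.X, (x : OnePoint ℂ) ∈ S) :
    FiniteDimensional ℂ (E.Lup Y).H0 :=
  have := E.finite_quot_LX hY hS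
  Module.Finite.equiv (E.quotEquiv hZ hY hS).symm

/-- The canonical isomorphism `detRΓ(L) ≃ det H⁰(L_Y^up) ⊗ (det H⁰(L_Y^up / L))⁻¹` exists and is
unique; it is applied to `L = L_Y` and `L = L_X`. -/
theorem existsUnique_inducedDetIso_of_stalk_eq (hZ : E.Z ≠ 0) (hY : Y ⊆ E.X)
    (hS : ∀ x ∈ E.X, (x : OnePoint ℂ) ∈ S) {L : Bundle (Fin p ⊕ Fin q)}
    (hL : ∀ x, L.stalk x ≤ (E.Lup Y).stalk x) (hL' : ∀ x ∉ S, (E.Lup Y).stalk x = L.stalk x)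
    [FiniteDimensional ℂ (L.Quot (E.Lup Y) S)] :
    ∃! e, IsInducedDetIso (L.inclH0 (E.Lup Y) hL) (L.toQuot (E.Lup Y) S)
      (L.connecting (E.Lup Y) S) e := by
  have := E.finite_H0_Lup hZ hY hS
  have hδ := Bundle.connecting_surjective hL' (E.exists_mittagLeffler_Lup hZ hY S)
  have : FiniteDimensional ℂ L.H0 := Module.Finite.of_injective _ (Bundle.inclH0_injective hL)
  have : FiniteDimensional ℂ (L.H1 S) := Module.Finite.of_surjective _ hδ
  exact existsUnique_isInducedDetIso (Bundle.inclH0_injective hL)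
    (Bundle.exact_inclH0_toQuot hL hL') (Bundle.exact_toQuot_connecting hL hL') hδ

/-- The formula `τ(L_Y) = det(1 - K) τ(L_X)` for any choice of the canonical isomorphisms. -/
theorem tau_eq_fredholm_smul (hZ : E.Z ≠ 0) (hY : Y ⊆ E.X)
    (hS : ∀ x ∈ E.X, (x : OnePoint ℂ) ∈ S)
    {eY : (E.L Y).DetRGamma S ≃ₗ[ℂ]
      (DetLine (E.Lup Y).H0 ⊗[ℂ] Dual ℂ (DetLine ((E.L Y).Quot (E.Lup Y) S)))}
    {eX : (E.L E.X).DetRGamma S ≃ₗ[ℂ]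
      (DetLine (E.Lup Y).H0 ⊗[ℂ] Dual ℂ (DetLine ((E.L E.X).Quot (E.Lup Y) S)))}
    (heY : IsInducedDetIso ((E.L Y).inclH0 (E.Lup Y) (E.L_le_Lup Y))
      ((E.L Y).toQuot (E.Lup Y) S) ((E.L Y).connecting (E.Lup Y) S) eY)
    (heX : IsInducedDetIso ((E.L E.X).inclH0 (E.Lup Y) (E.LX_le_Lup hY))
      ((E.L E.X).toQuot (E.Lup Y) S) ((E.L E.X).connecting (E.Lup Y) S) eX) :
    (E.L Y).tau S = E.fredholm (E.X \ Y) • ((E.L E.X).tau S ∘ₗ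
      (eY ≪≫ₗ TensorProduct.congr (LinearEquiv.refl ℂ _)
        (detCongr (E.fEquiv hY hS ≪≫ₗ (E.gEquiv Y hS).symm)).dualMap ≪≫ₗ eX.symm).toLinearMap) := by
  by_cases hfr : E.fredholm (E.X \ Y) = 0
  · have hnot : ¬ (E.L Y).Iso (split fun _ => -1) := fun h =>
      E.fredholm_ne_zero_of_iso hZ hY h hfr
    rw [hfr, zero_smul, Bundle.tau, if_neg hnot]
  · have hX := E.LX_iso hZ
    have hiso := E.L_iso ((E.fredholm_ne_zero_iff hZ hY).mp hfr)
    refine hiso.dual_ext ?_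
    have := hX.subsingleton_H0
    have := hX.subsingleton_H1 S
    have := hiso.subsingleton_H0
    have := hiso.subsingleton_H1 S
    have := E.finite_H0_Lup hZ hY hS
    have := E.finite_quot_LY Y hS
    have h := inducedDetIso_detOne_eq_det_smul heY heX finrank_zero_of_subsingleton
      finrank_zero_of_subsingleton finrank_zero_of_subsingleton finrank_zero_of_subsingleton
      (E.toQuot_LY_injective_of_iso hS hiso)
      (E.quotEquiv hZ hY hS ≪≫ₗ E.fEquiv hY hS ≪≫ₗ (E.gEquiv Y hS).symm).finrank_eq
      (E.fEquiv hY hS ≪≫ₗ (E.gEquiv Y hS).symm) (E.toQuot_LY_eq hZ hY hS)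
      (E.det_oneSubKernel hZ hY hS)
    have h2 := dual_apply_eq_of_apply_eq_smul ((E.L E.X).tau S) h
    exact ((hiso.tau_apply_detOne S).trans (hX.tau_apply_detOne S).symm).trans h2

end Ensemble

end GapTau

end

theorem mainTheorem1 {p q : ℕ} [NeZero q] (E : GapTau.Ensemble p q) (hZ : E.Z ≠ 0)
    (S : Finset (OnePoint ℂ)) (hS₀ : S.Nonempty) (hS : ∀ x ∈ E.X, (x : OnePoint ℂ) ∈ S)
    (Y : Finset ℂ) (hY : Y ⊆ E.X) :
    (E.L E.X).tau S ≠ 0 ∧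
    ∃ Φ : (E.L Y).DetRGamma S ≃ₗ[ℂ] (E.L E.X).DetRGamma S,
      (E.IsIdentification hY S hS Φ ∧ ∀ Φ', E.IsIdentification hY S hS Φ' → Φ' = Φ) ∧
      (E.L Y).tau S = E.fredholm (E.X \ Y) • ((E.L E.X).tau S ∘ₗ Φ.toLinearMap) := by
  have hτX := (E.LX_iso hZ).tau_apply_detOne S
  refine ⟨fun h => ?_, ?_⟩
  · rw [h, LinearMap.zero_apply] at hτX
    exact zero_ne_one hτX
  have := E.finite_quot_LX hY hS
  have := E.finite_quot_LY Y hS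
  have hY' := E.existsUnique_inducedDetIso_of_stalk_eq hZ hY hS (E.L_le_Lup Y)
    (E.Lup_stalk_eq_LY_of_notMem hS)
  have hX' := E.existsUnique_inducedDetIso_of_stalk_eq hZ hY hS (E.LX_le_Lup hY)
    (E.Lup_stalk_eq_LX_of_notMem hY hS)
  obtain ⟨eY, heY, heY'⟩ := hY'
  obtain ⟨eX, heX, heX'⟩ := hX'
  refine ⟨eY ≪≫ₗ TensorProduct.congr (LinearEquiv.refl ℂ _)
    (GapTau.detCongr (E.fEquiv hY hS ≪≫ₗ (E.gEquiv Y hS).symm)).dualMap ≪≫ₗ eX.symm,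
    ⟨⟨eY, eX, E.fEquiv hY hS, E.gEquiv Y hS, heY, heX, rfl, rfl, rfl⟩, ?_⟩,
    E.tau_eq_fredholm_smul hZ hY hS heY heX⟩
  rintro Φ' ⟨eY₁, eX₁, f₁, g₁, h1, h2, h3, h4, h5⟩
  have hf : f₁ = E.fEquiv hY hS := LinearEquiv.toLinearMap_injective h3
  have hg : g₁ = E.gEquiv Y hS := LinearEquiv.toLinearMap_injective h4
  rw [h5, heY' _ h1, heX' _ h2, hf, hg]
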